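/- \textbf{Setting.} Let $\Omega\subset\mathbb{R}^3$ be a bounded, connected, nonempty open set with Lipschitz boundary $\Gamma$. Let $\varepsilon_0,c>0$ be constants, and for $s\in\{1,2\}$ let $\nu_s,\Omega_{cs},\omega_{ps}:\Omega\to\mathbb{R}$ be measurable functions and $\mathbf{b}:\Omega\to\mathbb{R}^3$ a measurable field of unit vectors, such that for some constants $\nu^*,\Omega^*,\omega^*>0$ and almost every $x\in\Omega$ $$0\le\nu_s(x)\le\nu^*,\qquad |\Omega_{cs}(x)|\le\Omega^*,\qquad 0<\omega_{ps}(x)\le\omega^*\qquad(s=1,2).$$ Let $\mathbb{M}_s(x)$ be the matrix with $\mathbb{M}_s(x)v=\Omega_{cs}(x)\,\mathbf{b}(x)\times v+\nu_s(x)\,v$ for $v\in\mathbb{C}^3$. Put $\mathbf{L}^2(\Omega)=L^2(\Omega;\mathbb{C}^3)$, with norm $\|\cdot\|$, and let $\mathbf{L}^2_{(s)}(\Omega)$ be the space of measurable $w:\Omega\to\mathbb{C}^3$ with $w/\omega_{ps}\in\mathbf{L}^2(\Omega)$. The energy space is $$\mathbf{X}=\mathbf{L}^2_{(1)}(\Omega)\times\mathbf{L}^2_{(2)}(\Omega)\times\mathbf{L}^2(\Omega)\times\mathbf{L}^2(\Omega),$$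 $$\|U\|_{\mathbf{X}}^2=\frac1{\varepsilon_0}\sum_{s=1}^2\Big\|\frac{U_s}{\omega_{ps}}\Big\|^2+\varepsilon_0\|U_3\|^2+c^2\varepsilon_0\|U_4\|^2,\qquad U=(U_1,U_2,U_3,U_4),$$ a Hilbert space for the associated inner product. Let $\mathbf{H}(\operatorname{curl};\Omega)$ be the space of $v\in\mathbf{L}^2(\Omega)$ whose distributional curl is in $\mathbf{L}^2(\Omega)$, with its graph norm, and $\mathbf{H}_0(\operatorname{curl};\Omega)$ its subspace of fields with vanishing tangential trace on $\Gamma$, i.e. the closure of $C_c^\infty(\Omega;\mathbb{C}^3)$ in $\mathbf{H}(\operatorname{curl};\Omega)$. Define the unbounded operator $\mathbb{A}_1$ on $\mathbf{X}$ by $$D(\mathbb{A}_1)=\mathbf{L}^2_{(1)}(\Omega)\times\mathbf{L}^2_{(2)}(\Omega)\times\mathbf{H}_0(\operatorname{curl};\Omega)\times\mathbf{H}(\operatorname{curl};\Omega),$$ $$\mathbb{A}_1U=\Big(\mathbb{M}_1U_1-\varepsilon_0\omega_{p1}^2U_3,\ \mathbb{M}_2U_2-\varepsilon_0\omega_{p2}^2U_3,\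 \tfrac1{\varepsilon_0}(U_1+U_2)-c^2\operatorname{curl}U_4,\ \operatorname{curl}U_3\Big).$$ (This is the linearized cold plasma model for $U=(J_1,J_2,E,B)$ with a perfectly conducting boundary, $E\times n=0$ on $\Gamma$.) \textbf{Theorem.} The operator $-\mathbb{A}_1$ is the infinitesimal generator of a $C^0$-semigroup of contractions $(T_1(t))_{t\ge0}$ on $\mathbf{X}$. For every $U_0\in\mathbf{X}$, the function $U(t)=T_1(t)U_0$ belongs to $C^0(\mathbb{R}_{\ge0};\mathbf{X})$ and is the unique mild solution of $$\partial_tU(t)+\mathbb{A}_1U(t)=0\quad(t>0),\qquad U(0)=U_0,$$ i.e. the unique continuous $U:[0,\infty)\to\mathbf{X}$ such that, for all $t\ge0$, $\int_0^tU(s)\,ds\in D(\mathbb{A}_1)$ and $U(t)=U_0-\mathbb{A}_1\int_0^tU(s)\,ds$. It satisfies $\|U(t)\|_{\mathbf{X}}\le\|U_0\|_{\mathbf{X}}$ for all $t\ge0$. If moreover $U_0\in D(\mathbb{A}_1)$, then $U\in C^1(\mathbb{R}_{\ge0};\mathbf{X})\cap C^0(\mathbb{R}_{\ge0};D(\mathbb{A}_1))$,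 where $D(\mathbb{A}_1)$ carries the graph norm; $U$ is the unique classical solution of the problem (continuous on $[0,\infty)$ with $U(0)=U_0$ and, for every $t>0$, differentiable at $t$ with $U(t)\in D(\mathbb{A}_1)$ and $\partial_tU(t)=-\mathbb{A}_1U(t)$); and $\|\partial_tU(t)\|_{\mathbf{X}}\le\|\mathbb{A}_1U_0\|_{\mathbf{X}}$ for all $t\ge0$ (one-sided derivative at $t=0$). -/

import Mathlib

open MeasureTheory Set Filter Topology
open scoped ENNReal NNReal ContDiff

noncomputable section

/-- Physical space `ℝ³` with its Euclidean norm. -/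
abbrev R3 : Type := EuclideanSpace ℝ (Fin 3)

/-- `ℂ³` with its Hermitian norm, in which the fields take their values. -/
abbrev C3 : Type := EuclideanSpace ℂ (Fin 3)

/-! ### Domains -/

/-- A bounded, connected (and nonempty) open subset of `ℝ³` with a Lipschitz boundary: near each
boundary point, and in suitable orthonormal coordinates, `Ω` is the set of points lying strictly
above the graph of a Lipschitz function of two variables. -/
structure IsLipschitzDomain (Ω : Set R3) : Prop where
  isOpen : IsOpen Ω
  isBounded : Bornology.IsBounded Ω
  isConnected : IsConnected Ω
  lipschitz_boundary : ∀ x ∈ frontier Ω,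
    ∃ (e : R3 ≃ₗᵢ[ℝ] R3) (K : ℝ≥0) (f : EuclideanSpace ℝ (Fin 2) → ℝ),
      LipschitzWith K f ∧ ∀ᶠ y in 𝓝 x, (y ∈ Ω ↔ f !₂[e y 0, e y 1] < e y 2)

/-! ### The curl operator -/

/-- The partial derivative `∂ⱼ φₖ` of a vector field. -/
def partialDeriv (j k : Fin 3) (φ : R3 → C3) (x : R3) : ℂ :=
  (fderiv ℝ φ x (EuclideanSpace.single j 1)) k

/-- The classical curl of a vector field. -/
def classicalCurl (φ : R3 → C3) (x : R3) : C3 :=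
  !₂[partialDeriv 1 2 φ x - partialDeriv 2 1 φ x,
     partialDeriv 2 0 φ x - partialDeriv 0 2 φ x,
     partialDeriv 0 1 φ x - partialDeriv 1 0 φ x]

/-- Test fields: smooth fields with compact support in `Ω`. -/
structure IsTestField (Ω : Set R3) (φ : R3 → C3) : Prop where
  smooth : ContDiff ℝ ∞ φ
  hasCompactSupport : HasCompactSupport φ
  tsupport_subset : tsupport φ ⊆ Ω

/-- `u` and `g` belong to `L²(Ω)³` and `g` is the curl of `u` in the sense of distributions. -/
structure IsL2Curl (Ω : Set R3) (u g : R3 → C3) : Prop where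
  memLp : MemLp u 2 (volume.restrict Ω)
  memLp_curl : MemLp g 2 (volume.restrict Ω)
  integral_eq : ∀ φ : R3 → C3, IsTestField Ω φ →
    ∫ x in Ω, inner ℂ (classicalCurl φ x) (u x) = ∫ x in Ω, inner ℂ (φ x) (g x)

/-- The space `H(curl; Ω)`. -/
def MemHCurl (Ω : Set R3) (u : R3 → C3) : Prop :=
  ∃ g, IsL2Curl Ω u g

open scoped Classical in
/-- The distributional curl of a field of `H(curl; Ω)`, determined up to a null set of `Ω`. -/
def weakCurl (Ω : Set R3) (u : R3 → C3) : R3 → C3 :=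
  if h : MemHCurl Ω u then h.choose else 0

/-- The space `H₀(curl; Ω)` of fields with vanishing tangential trace: the closure in
`H(curl; Ω)` of the space of test fields. -/
def MemHCurlZero (Ω : Set R3) (u : R3 → C3) : Prop :=
  MemHCurl Ω u ∧ ∀ δ : ℝ≥0∞, 0 < δ → ∃ φ, IsTestField Ω φ ∧
    eLpNorm (u - φ) 2 (volume.restrict Ω) < δ ∧
    eLpNorm (weakCurl Ω u - classicalCurl φ) 2 (volume.restrict Ω) < δ

/-! ### The plasma and the energy space -/

/-- The data of the cold plasma model in `Ω`: the physical constants, the collision, cyclotron and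
plasma frequencies of the two species (indexed by `Fin 2`) and the direction of the external
magnetic field, subject to the standing bounds. -/
structure ColdPlasma (Ω : Set R3) where
  /-- electric permittivity of vacuum -/
  ε₀ : ℝ
  /-- speed of light -/
  c : ℝ
  /-- collision frequencies -/
  ν : Fin 2 → R3 → ℝ
  /-- (signed) cyclotron frequencies -/
  Ωc : Fin 2 → R3 → ℝ
  /-- plasma frequencies -/
  ωp : Fin 2 → R3 → ℝ
  /-- direction of the external magnetic field -/
  b : R3 → R3
  ε₀_pos : 0 < ε₀
  c_pos : 0 < c
  aemeasurable_ν : ∀ s, AEMeasurable (ν s) (volume.restrict Ω)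
  aemeasurable_Ωc : ∀ s, AEMeasurable (Ωc s) (volume.restrict Ω)
  aemeasurable_ωp : ∀ s, AEMeasurable (ωp s) (volume.restrict Ω)
  aemeasurable_b : AEMeasurable b (volume.restrict Ω)
  norm_b : ∀ᵐ x ∂volume.restrict Ω, ‖b x‖ = 1
  bound_ν : ∃ ν' > 0, ∀ s, ∀ᵐ x ∂volume.restrict Ω, 0 ≤ ν s x ∧ ν s x ≤ ν'
  bound_Ωc : ∃ Ω' > 0, ∀ s, ∀ᵐ x ∂volume.restrict Ω, |Ωc s x| ≤ Ω'
  bound_ωp : ∃ ω' > 0, ∀ s, ∀ᵐ x ∂volume.restrict Ω, 0 < ωp s x ∧ ωp s x ≤ ω'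

/-- The cross product `b × v` of a real and a complex vector. -/
def crossR (b : R3) (v : C3) : C3 :=
  !₂[(b 1 : ℂ) * v 2 - (b 2 : ℂ) * v 1,
     (b 2 : ℂ) * v 0 - (b 0 : ℂ) * v 2,
     (b 0 : ℂ) * v 1 - (b 1 : ℂ) * v 0]

namespace ColdPlasma

variable {Ω : Set R3} (P : ColdPlasma Ω)

/-- The matrix `𝕄ₛ(x)`, acting on `ℂ³` by `𝕄ₛ v = Ωcₛ b × v + νₛ v`. -/
def matM (s : Fin 2) (x : R3) (v : C3) : C3 :=
  P.Ωc s x • crossR (P.b x) v + P.ν s x • v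

/-- The weighted measure `dx / (ε₀ ωₚₛ²)` for the current density of the species `s`. -/
def measJ (s : Fin 2) : Measure R3 :=
  (volume.restrict Ω).withDensity fun x => ENNReal.ofReal (1 / (P.ε₀ * P.ωp s x ^ 2))

/-- The measure `ε₀ dx` for the electric field. -/
def measE : Measure R3 := ENNReal.ofReal P.ε₀ • volume.restrict Ω

/-- The measure `c² ε₀ dx` for the magnetic field. -/
def measB : Measure R3 := ENNReal.ofReal (P.c ^ 2 * P.ε₀) • volume.restrict Ω

/-- The energy space `X = L²₍₁₎(Ω) × L²₍₂₎(Ω) × L²(Ω) × L²(Ω)` of fields `(J₁, J₂, E, B)`. It is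
the Hilbert sum of `L²` spaces for the above measures, so that its squared norm is
`ε₀⁻¹ ∑ₛ ‖Jₛ / ωₚₛ‖² + ε₀ ‖E‖² + c² ε₀ ‖B‖²` (norms of `L²(Ω)` for Lebesgue's measure). -/
abbrev EnergySpace : Type :=
  WithLp 2 (PiLp 2 (fun s : Fin 2 => Lp C3 2 (P.measJ s)) ×
    WithLp 2 (Lp C3 2 P.measE × Lp C3 2 P.measB))

variable {P}

/-- The current density of the species `s`. -/
def J (U : P.EnergySpace) (s : Fin 2) : R3 → C3 := (U.fst s : Lp C3 2 (P.measJ s))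

/-- The electric field. -/
def E (U : P.EnergySpace) : R3 → C3 := (U.snd.fst : Lp C3 2 P.measE)

/-- The magnetic field. -/
def B (U : P.EnergySpace) : R3 → C3 := (U.snd.snd : Lp C3 2 P.measB)

/-- Component `s` of `𝔸 U`: the field `𝕄ₛ Jₛ - ε₀ ωₚₛ² E`. -/
def fieldJ (U : P.EnergySpace) (s : Fin 2) (x : R3) : C3 :=
  P.matM s x (J U s x) - (P.ε₀ * P.ωp s x ^ 2) • E U x

/-- Component 3 of `𝔸 U`: the field `ε₀⁻¹ (J₁ + J₂) - c² curl B`. -/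
def fieldE (U : P.EnergySpace) (x : R3) : C3 :=
  (1 / P.ε₀) • ∑ s, J U s x - P.c ^ 2 • weakCurl Ω (B U) x

/-- Component 4 of `𝔸 U`: the field `curl E`. -/
def fieldB (U : P.EnergySpace) (x : R3) : C3 := weakCurl Ω (E U) x

end ColdPlasma

/-! ### Helper facts: the operator is well defined -/

lemma isL2Curl_weakCurl {Ω : Set R3} {u : R3 → C3} (h : MemHCurl Ω u) :
    IsL2Curl Ω u (weakCurl Ω u) := by
  rw [weakCurl, dif_pos h]; exact h.choose_spec

lemma continuous_classicalCurl {φ : R3 → C3} (h : ContDiff ℝ ∞ φ) :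
    Continuous (classicalCurl φ) := by
  have h1 : Continuous (fderiv ℝ φ) := h.continuous_fderiv (by simp)
  have h2 : ∀ j k, Continuous (partialDeriv j k φ) := by
    intro j k
    unfold partialDeriv
    fun_prop
  unfold classicalCurl
  refine (PiLp.continuous_toLp 2 _).comp (continuous_pi fun i => ?_)
  fin_cases i <;> simp <;> fun_prop

lemma classicalCurl_eq_zero {φ : R3 → C3} {x : R3} (hx : x ∉ tsupport φ) :
    classicalCurl φ x = 0 := by
  have : fderiv ℝ φ x = 0 := by
    by_contra h
    exact hx (support_fderiv_subset ℝ h)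
  ext i
  fin_cases i <;> simp [classicalCurl, partialDeriv, this]

lemma integrable_inner_of_memLp {Ω : Set R3} {f g : R3 → C3} (hf : MemLp f 2 (volume.restrict Ω))
    (hg : MemLp g 2 (volume.restrict Ω)) :
    Integrable (fun x => inner ℂ (f x) (g x)) (volume.restrict Ω) := by
  have h := L2.integrable_inner (𝕜 := ℂ) hf.toLp hg.toLp
  refine h.congr ?_
  filter_upwards [hf.coeFn_toLp, hg.coeFn_toLp] with x h1 h2
  rw [h1, h2]

lemma IsTestField.memLp {Ω : Set R3} {φ : R3 → C3} (h : IsTestField Ω φ) :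
    MemLp φ 2 (volume.restrict Ω) :=
  (h.smooth.continuous.memLp_of_hasCompactSupport h.hasCompactSupport).restrict Ω

lemma IsTestField.memLp_curl {Ω : Set R3} {φ : R3 → C3} (h : IsTestField Ω φ) :
    MemLp (classicalCurl φ) 2 (volume.restrict Ω) :=
  ((continuous_classicalCurl h.smooth).memLp_of_hasCompactSupport
    (HasCompactSupport.intro h.hasCompactSupport fun _ hx => classicalCurl_eq_zero hx)).restrict Ω

lemma IsL2Curl.ae_eq {Ω : Set R3} (hΩ : IsOpen Ω) {u g g' : R3 → C3} (h : IsL2Curl Ω u g)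
    (h' : IsL2Curl Ω u g') : g =ᵐ[volume.restrict Ω] g' := by
  have hd : MemLp (fun x => g x - g' x) 2 (volume.restrict Ω) := h.memLp_curl.sub h'.memLp_curl
  have hloc : LocallyIntegrableOn (fun x => g x - g' x) Ω := by
    rw [locallyIntegrableOn_iff hΩ.isLocallyClosed]
    intro k hk hkc
    have hm : MemLp (fun x => g x - g' x) 2 (volume.restrict k) :=
      hd.mono_measure (Measure.restrict_mono hk le_rfl)
    have : IsFiniteMeasure (volume.restrict k) := ⟨by simpa using hkc.measure_lt_top⟩
    exact hm.integrable (by norm_num)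
  have key : ∀ i : Fin 3, ∀ᵐ x, x ∈ Ω → (g x - g' x) i = 0 := by
    intro i
    refine hΩ.ae_eq_zero_of_integral_contDiff_smul_eq_zero (f := fun x => (g x - g' x) i) ?_ ?_
    · rw [locallyIntegrableOn_iff hΩ.isLocallyClosed] at hloc ⊢
      intro k hk hkc
      exact (hloc k hk hkc).eval_piLp i
    · intro η hη hηc hηs
      set φ : R3 → C3 := fun x => EuclideanSpace.single i (η x : ℂ) with hφ
      have hsupp : tsupport φ ⊆ tsupport η := by
        refine closure_mono fun x hx => ?_
        contrapose! hx
        simp only [Function.mem_support, not_not] at hx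
        simp [hφ, hx]
      have htest : IsTestField Ω φ := by
        refine ⟨?_, ?_, hsupp.trans hηs⟩
        · rw [contDiff_piLp]
          intro j
          by_cases hj : j = i
          · subst hj
            have hc : (fun x => (φ x).ofLp j) = Complex.ofRealCLM ∘ η := by
              ext x
              simp [hφ]
            rw [hc]
            exact Complex.ofRealCLM.contDiff.comp hη
          · simpa [hφ, hj] using contDiff_const
        · exact hηc.of_isClosed_subset (isClosed_tsupport φ) hsupp
      have e := (h.integral_eq φ htest).symm.trans (h'.integral_eq φ htest)
      rw [← sub_eq_zero, ← integral_sub (integrable_inner_of_memLp htest.memLp h.memLp_curl)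
        (integrable_inner_of_memLp htest.memLp h'.memLp_curl)] at e
      rw [← setIntegral_eq_integral_of_forall_compl_eq_zero (s := Ω), ← e]
      · refine integral_congr_ae (Eventually.of_forall fun x => ?_)
        simp [hφ, EuclideanSpace.inner_single_left, mul_sub]
      · intro x hx
        rw [image_eq_zero_of_notMem_tsupport (fun hh => hx (hηs hh)), zero_smul]
  rw [EventuallyEq, ae_restrict_iff' hΩ.measurableSet]
  filter_upwards [ae_all_iff.2 key] with x hx hxΩ
  ext i
  simpa [sub_eq_zero] using hx i hxΩ

lemma IsL2Curl.congr {Ω : Set R3} {u u' g g' : R3 → C3} (h : IsL2Curl Ω u g)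
    (hu : u =ᵐ[volume.restrict Ω] u') (hg : g =ᵐ[volume.restrict Ω] g') : IsL2Curl Ω u' g' where
  memLp := h.memLp.ae_eq hu
  memLp_curl := h.memLp_curl.ae_eq hg
  integral_eq φ hφ := by
    have e := h.integral_eq φ hφ
    have e1 : ∫ x in Ω, inner ℂ (classicalCurl φ x) (u x)
        = ∫ x in Ω, inner ℂ (classicalCurl φ x) (u' x) :=
      integral_congr_ae (by filter_upwards [hu] with x hx; rw [hx])
    have e2 : ∫ x in Ω, inner ℂ (φ x) (g x) = ∫ x in Ω, inner ℂ (φ x) (g' x) :=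
      integral_congr_ae (by filter_upwards [hg] with x hx; rw [hx])
    rw [← e1, ← e2, e]

lemma IsL2Curl.add {Ω : Set R3} {u u' g g' : R3 → C3} (h : IsL2Curl Ω u g)
    (h' : IsL2Curl Ω u' g') : IsL2Curl Ω (u + u') (g + g') where
  memLp := h.memLp.add h'.memLp
  memLp_curl := h.memLp_curl.add h'.memLp_curl
  integral_eq φ hφ := by
    simp only [Pi.add_apply, inner_add_right]
    rw [integral_add (integrable_inner_of_memLp hφ.memLp_curl h.memLp)
      (integrable_inner_of_memLp hφ.memLp_curl h'.memLp),
      integral_add (integrable_inner_of_memLp hφ.memLp h.memLp_curl)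
      (integrable_inner_of_memLp hφ.memLp h'.memLp_curl), h.integral_eq φ hφ, h'.integral_eq φ hφ]

lemma IsL2Curl.smul {Ω : Set R3} {u g : R3 → C3} (a : ℂ) (h : IsL2Curl Ω u g) :
    IsL2Curl Ω (a • u) (a • g) where
  memLp := h.memLp.const_smul a
  memLp_curl := h.memLp_curl.const_smul a
  integral_eq φ hφ := by
    simp only [Pi.smul_apply, inner_smul_right, integral_const_mul, h.integral_eq φ hφ]

lemma isL2Curl_zero (Ω : Set R3) : IsL2Curl Ω 0 0 where
  memLp := MemLp.zero
  memLp_curl := MemLp.zero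
  integral_eq φ _ := by simp

lemma classicalCurl_add {φ ψ : R3 → C3} (hφ : ContDiff ℝ ∞ φ) (hψ : ContDiff ℝ ∞ ψ) :
    classicalCurl (φ + ψ) = classicalCurl φ + classicalCurl ψ := by
  ext x i
  have := fderiv_add (𝕜 := ℝ) (hφ.differentiable (by simp) x) (hψ.differentiable (by simp) x)
  fin_cases i <;> simp [classicalCurl, partialDeriv, this] <;> ring

lemma classicalCurl_smul (a : ℂ) {φ : R3 → C3} (hφ : ContDiff ℝ ∞ φ) :
    classicalCurl (a • φ) = a • classicalCurl φ := by
  ext x i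
  have := fderiv_const_smul (𝕜 := ℝ) (hφ.differentiable (by simp) x) a
  fin_cases i <;> simp [classicalCurl, partialDeriv, this] <;> ring

lemma IsTestField.add {Ω : Set R3} {φ ψ : R3 → C3} (hφ : IsTestField Ω φ) (hψ : IsTestField Ω ψ) :
    IsTestField Ω (φ + ψ) :=
  ⟨hφ.smooth.add hψ.smooth, hφ.hasCompactSupport.add hψ.hasCompactSupport,
    (tsupport_add φ ψ).trans (union_subset hφ.tsupport_subset hψ.tsupport_subset)⟩

lemma IsTestField.smul {Ω : Set R3} (a : ℂ) {φ : R3 → C3} (hφ : IsTestField Ω φ) :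
    IsTestField Ω (a • φ) := by
  have hs : tsupport (a • φ) ⊆ tsupport φ := closure_mono (Function.support_const_smul_subset a φ)
  exact ⟨hφ.smooth.const_smul a,
    hφ.hasCompactSupport.of_isClosed_subset (isClosed_tsupport _) hs,
    hs.trans hφ.tsupport_subset⟩

lemma weakCurl_ae_eq {Ω : Set R3} (hΩ : IsOpen Ω) {u g : R3 → C3} (h : IsL2Curl Ω u g) :
    weakCurl Ω u =ᵐ[volume.restrict Ω] g :=
  (isL2Curl_weakCurl ⟨g, h⟩).ae_eq hΩ h

lemma MemHCurl.congr {Ω : Set R3} {u u' : R3 → C3} (h : MemHCurl Ω u)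
    (hu : u =ᵐ[volume.restrict Ω] u') : MemHCurl Ω u' :=
  ⟨_, (isL2Curl_weakCurl h).congr hu ae_eq_rfl⟩

lemma MemHCurlZero.congr {Ω : Set R3} (hΩ : IsOpen Ω) {u u' : R3 → C3} (h : MemHCurlZero Ω u)
    (hu : u =ᵐ[volume.restrict Ω] u') : MemHCurlZero Ω u' := by
  refine ⟨h.1.congr hu, fun δ hδ => ?_⟩
  obtain ⟨φ, hφ, h1, h2⟩ := h.2 δ hδ
  have hc := weakCurl_ae_eq hΩ ((isL2Curl_weakCurl h.1).congr hu ae_eq_rfl)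
  refine ⟨φ, hφ, ?_, ?_⟩
  · rwa [← eLpNorm_congr_ae (hu.sub (ae_eq_refl φ))]
  · rwa [eLpNorm_congr_ae (hc.sub (ae_eq_refl (classicalCurl φ)))]

lemma MemHCurlZero.add {Ω : Set R3} (hΩ : IsOpen Ω) {u u' : R3 → C3} (h : MemHCurlZero Ω u)
    (h' : MemHCurlZero Ω u') : MemHCurlZero Ω (u + u') := by
  have hw := isL2Curl_weakCurl h.1
  have hw' := isL2Curl_weakCurl h'.1
  refine ⟨⟨_, hw.add hw'⟩, fun δ hδ => ?_⟩
  obtain ⟨φ, hφ, h1, h2⟩ := h.2 (δ / 2) (ENNReal.half_pos hδ.ne')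
  obtain ⟨ψ, hψ, h3, h4⟩ := h'.2 (δ / 2) (ENNReal.half_pos hδ.ne')
  have hc := weakCurl_ae_eq hΩ (hw.add hw')
  refine ⟨φ + ψ, hφ.add hψ, ?_, ?_⟩
  · have e : u + u' - (φ + ψ) = (u - φ) + (u' - ψ) := by abel
    rw [e]
    refine (eLpNorm_add_le (hw.memLp.sub hφ.memLp).1 (hw'.memLp.sub hψ.memLp).1
      (by norm_num)).trans_lt ?_
    exact (ENNReal.add_lt_add h1 h3).trans_eq (ENNReal.add_halves δ)
  · rw [eLpNorm_congr_ae (hc.sub (ae_eq_refl (classicalCurl (φ + ψ)))),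
      classicalCurl_add hφ.smooth hψ.smooth]
    have e : weakCurl Ω u + weakCurl Ω u' - (classicalCurl φ + classicalCurl ψ)
      = (weakCurl Ω u - classicalCurl φ) + (weakCurl Ω u' - classicalCurl ψ) := by abel
    rw [e]
    refine (eLpNorm_add_le (hw.memLp_curl.sub hφ.memLp_curl).1
      (hw'.memLp_curl.sub hψ.memLp_curl).1 (by norm_num)).trans_lt ?_
    exact (ENNReal.add_lt_add h2 h4).trans_eq (ENNReal.add_halves δ)

lemma memHCurlZero_zero {Ω : Set R3} (hΩ : IsOpen Ω) : MemHCurlZero Ω 0 := by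
  have hc := weakCurl_ae_eq hΩ (isL2Curl_zero Ω)
  have h0 : IsTestField Ω (0 : R3 → C3) :=
    ⟨contDiff_const, HasCompactSupport.zero, by simp [tsupport]⟩
  have hz : classicalCurl (0 : R3 → C3) = 0 := by
    ext x i
    fin_cases i <;> simp [classicalCurl, partialDeriv]
  refine ⟨⟨0, isL2Curl_zero Ω⟩, fun δ hδ => ⟨0, h0, by simpa using hδ, ?_⟩⟩
  rw [eLpNorm_congr_ae (hc.sub (ae_eq_refl (classicalCurl (0 : R3 → C3)))), hz]
  simpa using hδ

lemma MemHCurlZero.smul {Ω : Set R3} (hΩ : IsOpen Ω) (a : ℂ) {u : R3 → C3}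
    (h : MemHCurlZero Ω u) : MemHCurlZero Ω (a • u) := by
  rcases eq_or_ne a 0 with rfl | ha
  · simpa using memHCurlZero_zero hΩ
  have hw := isL2Curl_weakCurl h.1
  have hc := weakCurl_ae_eq hΩ (hw.smul a)
  have hna : ‖a‖ₑ ≠ 0 := by simpa using ha
  have hnt : ‖a‖ₑ ≠ ⊤ := enorm_ne_top
  refine ⟨⟨_, hw.smul a⟩, fun δ hδ => ?_⟩
  obtain ⟨φ, hφ, h1, h2⟩ := h.2 (δ / ‖a‖ₑ) (ENNReal.div_pos hδ.ne' hnt)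
  refine ⟨a • φ, hφ.smul a, ?_, ?_⟩
  · rw [← smul_sub, eLpNorm_const_smul, mul_comm]
    exact ENNReal.mul_lt_of_lt_div h1
  · rw [eLpNorm_congr_ae (hc.sub (ae_eq_refl (classicalCurl (a • φ)))),
      classicalCurl_smul a hφ.smooth, ← smul_sub, eLpNorm_const_smul, mul_comm]
    exact ENNReal.mul_lt_of_lt_div h2

lemma crossR_add (b : R3) (v w : C3) : crossR b (v + w) = crossR b v + crossR b w := by
  ext i; fin_cases i <;> simp [crossR] <;> ring

lemma crossR_smul (b : R3) (a : ℂ) (v : C3) : crossR b (a • v) = a • crossR b v := by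
  ext i; fin_cases i <;> simp [crossR] <;> ring

lemma continuous_crossR : Continuous (fun p : R3 × C3 => crossR p.1 p.2) := by
  unfold crossR
  refine (PiLp.continuous_toLp 2 _).comp (continuous_pi fun i => ?_)
  fin_cases i <;> simp <;> fun_prop

lemma norm_crossR_le {b : R3} (hb : ‖b‖ = 1) (v : C3) : ‖crossR b v‖ ≤ 6 * ‖v‖ := by
  have hb' : ∀ i, ‖(b i : ℂ)‖ ≤ 1 := fun i => by
    rw [Complex.norm_real, ← hb]; exact PiLp.norm_apply_le b i
  have h1 : ∀ i j k l, ‖(b i : ℂ) * v j - (b k : ℂ) * v l‖ ≤ 2 * ‖v‖ := by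
    intro i j k l
    calc _ ≤ ‖(b i : ℂ) * v j‖ + ‖(b k : ℂ) * v l‖ := norm_sub_le _ _
      _ ≤ 1 * ‖v‖ + 1 * ‖v‖ := by
        rw [norm_mul, norm_mul]
        gcongr
        exacts [hb' i, PiLp.norm_apply_le v j, hb' k, PiLp.norm_apply_le v l]
      _ = 2 * ‖v‖ := by ring
  have h2 : ∀ i, ‖crossR b v i‖ ≤ 2 * ‖v‖ := by
    intro i; fin_cases i <;> simpa [crossR] using h1 _ _ _ _
  rw [EuclideanSpace.norm_eq]
  refine Real.sqrt_le_iff.2 ⟨by positivity, ?_⟩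
  rw [Fin.sum_univ_three]
  nlinarith [pow_le_pow_left₀ (norm_nonneg _) (h2 0) 2, pow_le_pow_left₀ (norm_nonneg _) (h2 1) 2,
    pow_le_pow_left₀ (norm_nonneg _) (h2 2) 2, sq_nonneg ‖v‖]

namespace ColdPlasma

variable {Ω : Set R3} {P : ColdPlasma Ω}

lemma aemeasurable_weight (P : ColdPlasma Ω) (s : Fin 2) :
    AEMeasurable (fun x => ENNReal.ofReal (1 / (P.ε₀ * P.ωp s x ^ 2))) (volume.restrict Ω) := by
  have := P.aemeasurable_ωp s
  fun_prop

lemma measJ_ac (P : ColdPlasma Ω) (s : Fin 2) : P.measJ s ≪ volume.restrict Ω :=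
  withDensity_absolutelyContinuous _ _

lemma ac_measJ (P : ColdPlasma Ω) (s : Fin 2) : volume.restrict Ω ≪ P.measJ s := by
  refine withDensity_absolutelyContinuous' (P.aemeasurable_weight s) ?_
  obtain ⟨w, -, hw⟩ := P.bound_ωp
  filter_upwards [hw s] with x hx
  have := P.ε₀_pos
  have := hx.1
  simp only [ne_eq, ENNReal.ofReal_eq_zero, not_le]
  positivity

lemma measE_ac (P : ColdPlasma Ω) : P.measE ≪ volume.restrict Ω := Measure.smul_absolutelyContinuous

lemma measB_ac (P : ColdPlasma Ω) : P.measB ≪ volume.restrict Ω := Measure.smul_absolutelyContinuous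

lemma ac_measE (P : ColdPlasma Ω) : volume.restrict Ω ≪ P.measE :=
  Measure.absolutelyContinuous_smul (by simpa using P.ε₀_pos)

lemma ac_measB (P : ColdPlasma Ω) : volume.restrict Ω ≪ P.measB :=
  Measure.absolutelyContinuous_smul (by
    have := P.ε₀_pos; have := P.c_pos
    simp only [ne_eq, ENNReal.ofReal_eq_zero, not_le]; positivity)

lemma memLp_measJ_iff (P : ColdPlasma Ω) (s : Fin 2) {f : R3 → C3}
    (hf : AEStronglyMeasurable f (volume.restrict Ω)) : MemLp f 2 (P.measJ s) ↔
      Integrable (fun x => 1 / (P.ε₀ * P.ωp s x ^ 2) * ‖f x‖ ^ 2) (volume.restrict Ω) := by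
  rw [memLp_two_iff_integrable_sq_norm (hf.mono_ac (P.measJ_ac s)), measJ,
    integrable_withDensity_iff_integrable_smul₀' (P.aemeasurable_weight s) (by simp)]
  refine integrable_congr (Eventually.of_forall fun x => ?_)
  have := P.ε₀_pos
  simp only [smul_eq_mul]
  rw [ENNReal.toReal_ofReal (by positivity)]

lemma memLp_E (U : P.EnergySpace) : MemLp (E U) 2 (volume.restrict Ω) := by
  have h : MemLp (E U) 2 P.measE := Lp.memLp U.snd.fst
  have := h.smul_measure (c := (ENNReal.ofReal P.ε₀)⁻¹) (by simpa using P.ε₀_pos)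
  rwa [measE, smul_smul, ENNReal.inv_mul_cancel (by simpa using P.ε₀_pos) ENNReal.ofReal_ne_top,
    one_smul] at this

lemma memLp_J (U : P.EnergySpace) (s : Fin 2) : MemLp (J U s) 2 (volume.restrict Ω) := by
  have h : MemLp (J U s) 2 (P.measJ s) := Lp.memLp (U.fst s)
  have hm : AEStronglyMeasurable (J U s) (volume.restrict Ω) := h.1.mono_ac (P.ac_measJ s)
  rw [memLp_measJ_iff P s hm] at h
  rw [memLp_two_iff_integrable_sq_norm hm]
  obtain ⟨w, hw0, hw⟩ := P.bound_ωp
  refine (h.const_mul (P.ε₀ * w ^ 2)).mono (hm.norm.pow 2) ?_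
  filter_upwards [hw s] with x hx
  have h1 := P.ε₀_pos
  have h2 := hx.1
  rw [Real.norm_of_nonneg (by positivity), Real.norm_of_nonneg (by positivity), ← mul_assoc,
    mul_one_div]
  refine le_mul_of_one_le_left (by positivity) ((one_le_div (by positivity)).2 ?_)
  have := hx.2
  gcongr

lemma memLp_matM (U : P.EnergySpace) (s : Fin 2) :
    MemLp (fun x => P.matM s x (J U s x)) 2 (P.measJ s) := by
  have hJ : MemLp (J U s) 2 (P.measJ s) := Lp.memLp (U.fst s)
  have hJm := (memLp_J U s).1
  have hb := P.aemeasurable_b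
  have hν := P.aemeasurable_ν s
  have hΩc := P.aemeasurable_Ωc s
  obtain ⟨n, hn0, hn⟩ := P.bound_ν
  obtain ⟨o, ho0, ho⟩ := P.bound_Ωc
  refine hJ.of_le_mul (c := o * 6 + n) ?_ ?_
  · refine AEStronglyMeasurable.mono_ac (P.measJ_ac s) ?_
    exact (hΩc.aestronglyMeasurable.smul (continuous_crossR.comp_aestronglyMeasurable
      (hb.aestronglyMeasurable.prodMk hJm))).add (hν.aestronglyMeasurable.smul hJm)
  · refine (P.measJ_ac s).ae_le ?_
    filter_upwards [hn s, ho s, P.norm_b] with x h1 h2 h3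
    unfold matM
    refine (norm_add_le _ _).trans ?_
    rw [norm_smul, norm_smul, add_mul, mul_assoc]
    have := norm_crossR_le h3 (J U s x)
    gcongr
    · exact h2
    · rw [Real.norm_of_nonneg h1.1]; exact h1.2

lemma memLp_weight_E (U : P.EnergySpace) (s : Fin 2) :
    MemLp (fun x => (P.ε₀ * P.ωp s x ^ 2) • E U x) 2 (P.measJ s) := by
  have hEm := (memLp_E U).1
  have hωp := P.aemeasurable_ωp s
  have hm : AEStronglyMeasurable (fun x => (P.ε₀ * P.ωp s x ^ 2) • E U x)
      (volume.restrict Ω) :=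
    ((hωp.pow_const 2).const_mul P.ε₀).aestronglyMeasurable.smul hEm
  rw [memLp_measJ_iff P s hm]
  obtain ⟨w, hw0, hw⟩ := P.bound_ωp
  have hi := (memLp_two_iff_integrable_sq_norm hEm).1 (memLp_E U)
  refine (hi.const_mul (P.ε₀ * w ^ 2)).mono ?_ ?_
  · have h5 := hm.norm.pow 2
    have h6 : AEStronglyMeasurable (fun x => 1 / (P.ε₀ * P.ωp s x ^ 2)) (volume.restrict Ω) :=
      AEMeasurable.aestronglyMeasurable (by fun_prop)
    exact h6.mul h5
  · filter_upwards [hw s] with x hx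
    have h1 := P.ε₀_pos
    have h2 := hx.1
    have h3 := hx.2
    have e : 1 / (P.ε₀ * P.ωp s x ^ 2) * ‖(P.ε₀ * P.ωp s x ^ 2) • E U x‖ ^ 2
        = P.ε₀ * P.ωp s x ^ 2 * ‖E U x‖ ^ 2 := by
      rw [norm_smul, Real.norm_of_nonneg (by positivity)]
      field_simp
    rw [e, Real.norm_of_nonneg (by positivity), Real.norm_of_nonneg (by positivity)]
    gcongr

lemma memLp_fieldJ (U : P.EnergySpace) (s : Fin 2) : MemLp (fieldJ U s) 2 (P.measJ s) :=
  (memLp_matM U s).sub (memLp_weight_E U s)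

lemma memLp_fieldE (U : P.EnergySpace) (hB : MemHCurl Ω (B U)) :
    MemLp (fieldE U) 2 P.measE := by
  refine MemLp.smul_measure ?_ ENNReal.ofReal_ne_top
  refine MemLp.sub (f := fun x => (1 / P.ε₀) • ∑ s, J U s x) ?_ ?_
  · exact (memLp_finsetSum Finset.univ fun s _ => memLp_J U s).const_smul (1 / P.ε₀)
  · exact (isL2Curl_weakCurl hB).memLp_curl.const_smul (P.c ^ 2)

lemma memLp_fieldB (U : P.EnergySpace) (hE : MemHCurl Ω (E U)) :
    MemLp (fieldB U) 2 P.measB :=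
  (isL2Curl_weakCurl hE).memLp_curl.smul_measure ENNReal.ofReal_ne_top

lemma J_add (U V : P.EnergySpace) (s : Fin 2) :
    J (U + V) s =ᵐ[volume.restrict Ω] J U s + J V s :=
  (P.ac_measJ s).ae_le (Lp.coeFn_add (U.fst s) (V.fst s))

lemma E_add (U V : P.EnergySpace) : E (U + V) =ᵐ[volume.restrict Ω] E U + E V :=
  P.ac_measE.ae_le (Lp.coeFn_add U.snd.fst V.snd.fst)

lemma B_add (U V : P.EnergySpace) : B (U + V) =ᵐ[volume.restrict Ω] B U + B V :=
  P.ac_measB.ae_le (Lp.coeFn_add U.snd.snd V.snd.snd)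

lemma J_smul (a : ℂ) (U : P.EnergySpace) (s : Fin 2) :
    J (a • U) s =ᵐ[volume.restrict Ω] a • J U s :=
  (P.ac_measJ s).ae_le (Lp.coeFn_smul a (U.fst s))

lemma E_smul (a : ℂ) (U : P.EnergySpace) : E (a • U) =ᵐ[volume.restrict Ω] a • E U :=
  P.ac_measE.ae_le (Lp.coeFn_smul a U.snd.fst)

lemma B_smul (a : ℂ) (U : P.EnergySpace) : B (a • U) =ᵐ[volume.restrict Ω] a • B U :=
  P.ac_measB.ae_le (Lp.coeFn_smul a U.snd.snd)

lemma weakCurl_E_add (hΩ : IsOpen Ω) {U V : P.EnergySpace} (hU : MemHCurl Ω (E U))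
    (hV : MemHCurl Ω (E V)) :
    weakCurl Ω (E (U + V)) =ᵐ[volume.restrict Ω] weakCurl Ω (E U) + weakCurl Ω (E V) :=
  weakCurl_ae_eq hΩ (((isL2Curl_weakCurl hU).add (isL2Curl_weakCurl hV)).congr
    (E_add U V).symm ae_eq_rfl)

lemma weakCurl_B_add (hΩ : IsOpen Ω) {U V : P.EnergySpace} (hU : MemHCurl Ω (B U))
    (hV : MemHCurl Ω (B V)) :
    weakCurl Ω (B (U + V)) =ᵐ[volume.restrict Ω] weakCurl Ω (B U) + weakCurl Ω (B V) :=
  weakCurl_ae_eq hΩ (((isL2Curl_weakCurl hU).add (isL2Curl_weakCurl hV)).congr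
    (B_add U V).symm ae_eq_rfl)

lemma weakCurl_E_smul (hΩ : IsOpen Ω) (a : ℂ) {U : P.EnergySpace} (hU : MemHCurl Ω (E U)) :
    weakCurl Ω (E (a • U)) =ᵐ[volume.restrict Ω] a • weakCurl Ω (E U) :=
  weakCurl_ae_eq hΩ (((isL2Curl_weakCurl hU).smul a).congr (E_smul a U).symm ae_eq_rfl)

lemma weakCurl_B_smul (hΩ : IsOpen Ω) (a : ℂ) {U : P.EnergySpace} (hU : MemHCurl Ω (B U)) :
    weakCurl Ω (B (a • U)) =ᵐ[volume.restrict Ω] a • weakCurl Ω (B U) :=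
  weakCurl_ae_eq hΩ (((isL2Curl_weakCurl hU).smul a).congr (B_smul a U).symm ae_eq_rfl)

/-! ### The evolution operator -/

/-- The domain `D(𝔸₁) = L²₍₁₎(Ω) × L²₍₂₎(Ω) × H₀(curl; Ω) × H(curl; Ω)`. -/
def domainA (hΩ : IsLipschitzDomain Ω) (P : ColdPlasma Ω) : Submodule ℂ P.EnergySpace where
  carrier := {U | MemHCurlZero Ω (E U) ∧ MemHCurl Ω (B U)}
  add_mem' := by
    rintro U V ⟨h1, h2⟩ ⟨h3, h4⟩
    refine ⟨(h1.add hΩ.isOpen h3).congr hΩ.isOpen (E_add U V).symm, ?_⟩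
    exact ⟨_, ((isL2Curl_weakCurl h2).add (isL2Curl_weakCurl h4)).congr
      (B_add U V).symm ae_eq_rfl⟩
  zero_mem' := by
    refine ⟨(memHCurlZero_zero hΩ.isOpen).congr hΩ.isOpen ?_, ⟨0, (isL2Curl_zero Ω).congr ?_
      ae_eq_rfl⟩⟩
    · have h : E (0 : P.EnergySpace) =ᵐ[volume.restrict Ω] 0 :=
        P.ac_measE.ae_le (Lp.coeFn_zero C3 2 P.measE)
      exact h.symm
    · have h : B (0 : P.EnergySpace) =ᵐ[volume.restrict Ω] 0 :=
        P.ac_measB.ae_le (Lp.coeFn_zero C3 2 P.measB)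
      exact h.symm
  smul_mem' := by
    rintro a U ⟨h1, h2⟩
    refine ⟨(h1.smul hΩ.isOpen a).congr hΩ.isOpen (E_smul a U).symm, ?_⟩
    exact ⟨_, ((isL2Curl_weakCurl h2).smul a).congr (B_smul a U).symm ae_eq_rfl⟩

/-- The unbounded operator `𝔸₁` on the energy space, for a perfectly conducting boundary:
`𝔸₁ (J₁, J₂, E, B) = (𝕄₁ J₁ - ε₀ ωₚ₁² E, 𝕄₂ J₂ - ε₀ ωₚ₂² E, ε₀⁻¹ (J₁ + J₂) - c² curl B, curl E)`. -/
def operatorA (hΩ : IsLipschitzDomain Ω) (P : ColdPlasma Ω) :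
    P.EnergySpace →ₗ.[ℂ] P.EnergySpace where
  domain := domainA hΩ P
  toFun :=
    { toFun := fun U => WithLp.toLp 2
        (WithLp.toLp 2 fun s => (memLp_fieldJ U.1 s).toLp,
          WithLp.toLp 2 ((memLp_fieldE U.1 U.2.2).toLp, (memLp_fieldB U.1 U.2.1.1).toLp))
      map_add' := by
        rintro ⟨U, hU⟩ ⟨V, hV⟩
        have hE := E_add U V
        have hcE := weakCurl_E_add hΩ.isOpen hU.1.1 hV.1.1
        have hcB := weakCurl_B_add hΩ.isOpen hU.2 hV.2
        refine (WithLp.ofLp_injective 2) (Prod.ext ?_ ((WithLp.ofLp_injective 2) (Prod.ext ?_ ?_)))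
        · ext1 s
          refine (MemLp.toLp_eq_toLp_iff (memLp_fieldJ (U + V) s) ((memLp_fieldJ U s).add (memLp_fieldJ V s))).2 ?_
          refine (P.measJ_ac s).ae_le ?_
          filter_upwards [hE, J_add U V s] with x h1 h2
          simp only [fieldJ, matM, Pi.add_apply, h1, h2, crossR_add, smul_add]
          abel
        · refine (MemLp.toLp_eq_toLp_iff
            (memLp_fieldE (U + V) ((domainA hΩ P).add_mem hU hV).2) ((memLp_fieldE U hU.2).add (memLp_fieldE V hV.2))).2 ?_
          refine P.measE_ac.ae_le ?_
          filter_upwards [hcB, J_add U V 0, J_add U V 1] with x h1 h2 h3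
          simp only [fieldE, Fin.sum_univ_two, Pi.add_apply, h1, h2, h3, smul_add]
          abel
        · refine (MemLp.toLp_eq_toLp_iff
            (memLp_fieldB (U + V) ((domainA hΩ P).add_mem hU hV).1.1) ((memLp_fieldB U hU.1.1).add (memLp_fieldB V hV.1.1))).2 ?_
          refine P.measB_ac.ae_le ?_
          filter_upwards [hcE] with x h1
          simp only [fieldB, Pi.add_apply, h1]
      map_smul' := by
        rintro a ⟨U, hU⟩
        have hE := E_smul a U
        have hcE := weakCurl_E_smul hΩ.isOpen a hU.1.1
        have hcB := weakCurl_B_smul hΩ.isOpen a hU.2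
        refine (WithLp.ofLp_injective 2) (Prod.ext ?_ ((WithLp.ofLp_injective 2) (Prod.ext ?_ ?_)))
        · ext1 s
          refine (MemLp.toLp_eq_toLp_iff (memLp_fieldJ (a • U) s) ((memLp_fieldJ U s).const_smul a)).2 ?_
          refine (P.measJ_ac s).ae_le ?_
          filter_upwards [hE, J_smul a U s] with x h1 h2
          simp only [fieldJ, matM, Pi.smul_apply, h1, h2, crossR_smul, smul_sub, smul_add,
            smul_comm a]
        · refine (MemLp.toLp_eq_toLp_iff
            (memLp_fieldE (a • U) ((domainA hΩ P).smul_mem a hU).2) ((memLp_fieldE U hU.2).const_smul a)).2 ?_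
          refine P.measE_ac.ae_le ?_
          filter_upwards [hcB, J_smul a U 0, J_smul a U 1] with x h1 h2 h3
          simp only [fieldE, Fin.sum_univ_two, Pi.smul_apply, h1, h2, h3, smul_sub, smul_add,
            smul_comm a]
        · refine (MemLp.toLp_eq_toLp_iff
            (memLp_fieldB (a • U) ((domainA hΩ P).smul_mem a hU).1.1) ((memLp_fieldB U hU.1.1).const_smul a)).2 ?_
          refine P.measB_ac.ae_le ?_
          filter_upwards [hcE] with x h1
          simp only [fieldB, Pi.smul_apply, h1] }

end ColdPlasma

/-! ### Semigroups and evolution equations -/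

/-- A strongly continuous (`C⁰`) one-parameter semigroup of bounded operators. -/
structure IsC0Semigroup {X : Type*} [NormedAddCommGroup X] [NormedSpace ℂ X]
    (T : ℝ≥0 → X →L[ℂ] X) : Prop where
  map_zero : T 0 = ContinuousLinearMap.id ℂ X
  map_add : ∀ s t, T (s + t) = (T s).comp (T t)
  tendsto_zero : ∀ x, Tendsto (fun t => T t x) (𝓝 0) (𝓝 x)

/-- The operator `G` is the infinitesimal generator of `T`: its domain is the set of all `x` for
which `(T(t) x - x) / t` converges as `t → 0⁺`, and `G x` is the limit. -/
def IsGenerator {X : Type*} [NormedAddCommGroup X] [NormedSpace ℂ X]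
    (G : X →ₗ.[ℂ] X) (T : ℝ≥0 → X →L[ℂ] X) : Prop :=
  ∀ x y : X, (x, y) ∈ G.graph ↔
    Tendsto (fun t : ℝ≥0 => (t : ℝ)⁻¹ • (T t x - x)) (𝓝[>] 0) (𝓝 y)

/-- `U` is a mild solution of `∂ₜU + A U = 0`, `U(0) = U₀`: it is continuous on `[0, ∞)` and
`U(t) = U₀ - A ∫₀ᵗ U(s) ds` for all `t ≥ 0`. -/
structure IsMildSolution {X : Type*} [NormedAddCommGroup X] [NormedSpace ℂ X]
    (A : X →ₗ.[ℂ] X) (U₀ : X) (U : ℝ → X) : Prop where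
  continuousOn : ContinuousOn U (Ici 0)
  eq_sub : ∀ t, 0 ≤ t → ∃ h : (∫ s in (0 : ℝ)..t, U s) ∈ A.domain, U t = U₀ - A ⟨_, h⟩

/-- `U` is a classical solution of `∂ₜU + A U = 0` for `t > 0`, `U(0) = U₀`. -/
structure IsClassicalSolution {X : Type*} [NormedAddCommGroup X] [NormedSpace ℂ X]
    (A : X →ₗ.[ℂ] X) (U₀ : X) (U : ℝ → X) : Prop where
  continuousOn : ContinuousOn U (Ici 0)
  initial : U 0 = U₀
  hasDerivAt : ∀ t, 0 < t → ∃ h : U t ∈ A.domain, HasDerivAt U (-A ⟨U t, h⟩) t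

/-- `U ∈ C¹(ℝ≥0; X)`, with one-sided derivatives at `0`. -/
def IsC1 {X : Type*} [NormedAddCommGroup X] [NormedSpace ℂ X] (U : ℝ → X) : Prop :=
  ContDiffOn ℝ 1 U (Ici 0)

/-- The time derivative `∂ₜU(t)` for `t ≥ 0`, one-sided at `t = 0`. -/
def timeDeriv {X : Type*} [NormedAddCommGroup X] [NormedSpace ℂ X] (U : ℝ → X) (t : ℝ) : X :=
  derivWithin U (Ici 0) t

/-- `U ∈ C⁰(ℝ≥0; D(A))`, where `D(A)` carries the graph norm: `U` takes its values in `D(A)`, and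
`U` and `A U` are continuous on `[0, ∞)`. -/
def ContinuousIntoDomain {X : Type*} [NormedAddCommGroup X] [NormedSpace ℂ X]
    (A : X →ₗ.[ℂ] X) (U : ℝ → X) : Prop :=
  ∃ h : ∀ t : ℝ≥0, U t ∈ A.domain, Continuous fun t : ℝ≥0 => (U t, A ⟨U t, h t⟩)

end

/-! ### Maximal accretive operators and their Yosida approximations -/

section MaximalAccretive

variable {X : Type*} [NormedAddCommGroup X] [InnerProductSpace ℂ X]

/-! The operator splits as `A = K + S`. Here `K` is of order zero (cyclotron rotation, collisions,
exchange between currents and electric field) and `S = (0, 0, -c² curl B, curl E)`. The weights of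
the energy norm make the exchange terms and the two curl terms antisymmetric, and rotation by a real
cross product is skew-Hermitian. The only symmetric contribution left is the collision term, which
is nonnegative because `ν ≥ 0`.

`S` is skew-adjoint, not merely skew-symmetric. Green's formula between `H₀(curl)` and `H(curl)`
gives skew-symmetry (`maxwell_skew`). Conversely, a field that satisfies Green's formula against all
of `H(curl)` lies in `H₀(curl)`, because the closed graph of the curl on test fields equals its
double orthogonal complement (`memHCurlZero_of_integral_eq`). Hence no trace on the boundary has to
be constructed, and `eq_maxwell_of_weak_form` recovers the domain from the weak equation.

A skew-adjoint operator plus an accretive one with an everywhere defined adjoint is maximal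
accretive (`isMaximalAccretive_of_skewAdjoint`): `l + A` has closed range by coercivity, and a
vector orthogonal to the range solves the adjoint problem, whose energy identity makes it zero.

What remains is the Lumer–Phillips theorem on a Hilbert space (`IsMaximalAccretive.wellPosed`),
proved with Yosida approximations. These are bounded, accretive and commuting, so their exponentials
are contractions that converge strongly. The resolvent commutes with the limit, which gives
invariance of the domain, the generator and the regularity. Uniqueness is the decay of `‖w‖²` along
solutions. -/

lemma mul_norm_le_norm_smul_add (l : ℝ) {x y : X} (h : 0 ≤ (inner ℂ y x).re) :
    l * ‖x‖ ≤ ‖(l : ℂ) • x + y‖ := by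
  have h1 : (inner ℂ ((l : ℂ) • x + y) x).re = l * ‖x‖ ^ 2 + (inner ℂ y x).re := by
    rw [inner_add_left, inner_smul_left, inner_self_eq_norm_sq_to_K]
    simp [← Complex.ofReal_pow]
  have h2 : (inner ℂ ((l : ℂ) • x + y) x).re ≤ ‖(l : ℂ) • x + y‖ * ‖x‖ :=
    re_inner_le_norm (𝕜 := ℂ) _ _
  rcases (norm_nonneg x).eq_or_lt with h0 | h0
  · rw [← h0]; simp
  · exact le_of_mul_le_mul_right (by nlinarith) h0

/-- The operator `A` is accretive and `l + A` is onto for every `l > 0`. -/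
structure IsMaximalAccretive (A : X →ₗ.[ℂ] X) : Prop where
  re_inner_nonneg : ∀ u : A.domain, 0 ≤ (inner ℂ (A u) (u : X)).re
  surjective : ∀ l : ℝ, 0 < l → ∀ f : X, ∃ u : A.domain, (l : ℂ) • (u : X) + A u = f

/-- `R l` is a right inverse of `l + A` for all `l > 0`. -/
def IsResolvent (A : X →ₗ.[ℂ] X) (R : ℝ → X →L[ℂ] X) : Prop :=
  ∀ l : ℝ, 0 < l → ∀ x, ∃ h : R l x ∈ A.domain, (l : ℂ) • R l x + A ⟨R l x, h⟩ = x

/-- The Yosida approximation `l - l² (l + A)⁻¹` of `A`, in terms of the resolvent of `A`. -/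
noncomputable def yosida (R : ℝ → X →L[ℂ] X) (l : ℝ) : X →L[ℂ] X :=
  (l : ℂ) • (1 - (l : ℂ) • R l)

lemma yosida_apply (R : ℝ → X →L[ℂ] X) (l : ℝ) (x : X) :
    yosida R l x = (l : ℂ) • (x - (l : ℂ) • R l x) := rfl

/-! ### Resolvents: identities, commutation and convergence. -/

variable {A : X →ₗ.[ℂ] X} {R : ℝ → X →L[ℂ] X}

lemma IsMaximalAccretive.mul_norm_le (hA : IsMaximalAccretive A) (l : ℝ) (u : A.domain) :
    l * ‖(u : X)‖ ≤ ‖(l : ℂ) • (u : X) + A u‖ :=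
  mul_norm_le_norm_smul_add l (hA.re_inner_nonneg u)

lemma IsMaximalAccretive.eq_of_smul_add_eq (hA : IsMaximalAccretive A) {l : ℝ} (hl : 0 < l)
    {u v : A.domain} (h : (l : ℂ) • (u : X) + A u = (l : ℂ) • (v : X) + A v) : u = v := by
  have h1 := hA.mul_norm_le l (u - v)
  have h2 : (l : ℂ) • ((u - v : A.domain) : X) + A (u - v) = 0 := by
    rw [A.map_sub, Submodule.coe_sub, smul_sub, sub_add_sub_comm, h, sub_self]
  rw [h2, norm_zero] at h1
  have h3 : ‖((u - v : A.domain) : X)‖ = 0 :=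
    le_antisymm (nonpos_of_mul_nonpos_right h1 hl) (norm_nonneg _)
  exact sub_eq_zero.1 (Subtype.ext (norm_eq_zero.1 h3))

lemma IsMaximalAccretive.exists_resolvent (hA : IsMaximalAccretive A) :
    ∃ R, IsResolvent A R := by
  have : ∀ l : ℝ, ∃ Q : X →L[ℂ] X, 0 < l → ∀ x, ∃ h : Q x ∈ A.domain,
      (l : ℂ) • Q x + A ⟨Q x, h⟩ = x := by
    intro l
    by_cases hl : 0 < l
    swap
    -- For `l ≤ 0` the value is arbitrary: `IsResolvent` only constrains `l > 0`.
    · exact ⟨0, fun h => absurd h hl⟩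
    choose f hf using hA.surjective l hl
    let Q : X →ₗ[ℂ] X :=
      { toFun := fun x => f x
        map_add' := fun x y => by
          rw [← Submodule.coe_add]
          refine congrArg _ (hA.eq_of_smul_add_eq hl ?_)
          rw [hf, A.map_add, Submodule.coe_add, smul_add, add_add_add_comm, hf, hf]
        map_smul' := fun a x => by
          rw [RingHom.id_apply, ← Submodule.coe_smul]
          refine congrArg _ (hA.eq_of_smul_add_eq hl ?_)
          rw [hf, A.map_smul, Submodule.coe_smul, smul_comm, ← smul_add, hf] }
    refine ⟨Q.mkContinuous l⁻¹ fun x => ?_, fun _ x => ⟨(f x).2, hf x⟩⟩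
    have := hA.mul_norm_le l (f x)
    rw [hf] at this
    rw [inv_mul_eq_div, le_div_iff₀ hl, mul_comm]
    exact this
  choose R hR using this
  exact ⟨R, hR⟩

lemma IsResolvent.apply_eq (hR : IsResolvent A R) (hA : IsMaximalAccretive A) {l : ℝ} (hl : 0 < l)
    (u : A.domain) : R l ((l : ℂ) • (u : X) + A u) = u := by
  obtain ⟨h, e⟩ := hR l hl ((l : ℂ) • (u : X) + A u)
  exact congrArg Subtype.val (hA.eq_of_smul_add_eq hl (u := ⟨_, h⟩) e)

lemma IsResolvent.mul_norm_le (hR : IsResolvent A R) (hA : IsMaximalAccretive A) {l : ℝ}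
    (hl : 0 < l) (x : X) : l * ‖R l x‖ ≤ ‖x‖ := by
  obtain ⟨h, e⟩ := hR l hl x
  have := hA.mul_norm_le l ⟨R l x, h⟩
  rwa [e] at this

/-- The resolvent identity: apply `R l` to `x = (l + A) R m x + (m - l) R m x`. -/
lemma IsResolvent.sub_eq (hR : IsResolvent A R) (hA : IsMaximalAccretive A) {l m : ℝ}
    (hl : 0 < l) (hm : 0 < m) (x : X) : R l x = R m x + ((m - l : ℝ) : ℂ) • R l (R m x) := by
  obtain ⟨h, e⟩ := hR m hm x
  have e2 : R l ((l : ℂ) • R m x + A ⟨R m x, h⟩) = R m x := hR.apply_eq hA hl ⟨R m x, h⟩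
  rw [← (R l).map_smul]
  conv_rhs => enter [1]; rw [← e2]
  rw [← (R l).map_add]
  congr 1
  nth_rewrite 1 [← e]
  push_cast
  rw [sub_smul]
  abel

/-- The resolvent identity and its mirror image under `l ↔ m` express `R l x - R m x` as `m - l`
times either product, and `m - l` can be cancelled. -/
lemma IsResolvent.commute (hR : IsResolvent A R) (hA : IsMaximalAccretive A) {l m : ℝ}
    (hl : 0 < l) (hm : 0 < m) : Commute (R l) (R m) := by
  rcases eq_or_ne l m with rfl | hne
  · exact Commute.refl _
  ext x
  have h1 := hR.sub_eq hA hl hm x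
  have h2 := hR.sub_eq hA hm hl x
  have h3 : ((m - l : ℝ) : ℂ) • (R l (R m x) - R m (R l x)) = 0 := by
    have h4 : ((l - m : ℝ) : ℂ) = -((m - l : ℝ) : ℂ) := by push_cast; ring
    rw [h4, neg_smul, ← sub_eq_add_neg] at h2
    rw [smul_sub, ← sub_eq_of_eq_add' h1, ← sub_eq_of_eq_add' (eq_sub_iff_add_eq'.1 h2).symm]
    abel
  rcases smul_eq_zero.1 h3 with h | h
  · exact absurd (sub_eq_zero.1 (by exact_mod_cast h)) hne.symm
  · exact sub_eq_zero.1 h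

lemma IsResolvent.commute_yosida (hR : IsResolvent A R) (hA : IsMaximalAccretive A) {l m : ℝ}
    (hl : 0 < l) (hm : 0 < m) : Commute (R l) (yosida R m) :=
  ((Commute.one_right _).sub_right ((hR.commute hA hl hm).smul_right _)).smul_right _

lemma IsResolvent.yosida_commute (hR : IsResolvent A R) (hA : IsMaximalAccretive A) {l m : ℝ}
    (hl : 0 < l) (hm : 0 < m) : Commute (yosida R l) (yosida R m) :=
  ((Commute.one_left _).sub_left ((hR.commute_yosida hA hl hm).smul_left _)).smul_left _

/-- On the domain, `u = R l (l u + A u)`. This form gives both the convergence to `A u` and the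
bound by `‖A u‖` that is uniform in `l`. -/
lemma IsResolvent.yosida_apply_mem (hR : IsResolvent A R) (hA : IsMaximalAccretive A) {l : ℝ}
    (hl : 0 < l) (u : A.domain) : yosida R l u = (l : ℂ) • R l (A u) := by
  rw [yosida_apply]
  congr 1
  nth_rewrite 1 [← hR.apply_eq hA hl u]
  rw [map_add, map_smul, add_sub_cancel_left]

/-- With `v = R l x` one has `yosida R l x = l A v` and `x = l v + A v`, so the real part equals `l
(l Re ⟨A v, v⟩ + ‖A v‖²)`. -/
lemma IsResolvent.re_inner_yosida_nonneg (hR : IsResolvent A R) (hA : IsMaximalAccretive A) {l : ℝ}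
    (hl : 0 < l) (x : X) : 0 ≤ (inner ℂ (yosida R l x) x).re := by
  obtain ⟨h, e⟩ := hR l hl x
  have h1 := hA.re_inner_nonneg ⟨R l x, h⟩
  have h2 : yosida R l x = (l : ℂ) • A ⟨R l x, h⟩ := by
    rw [yosida_apply, sub_eq_of_eq_add']
    exact e.symm
  rw [h2]
  nth_rewrite 2 [← e]
  rw [inner_smul_left, inner_add_right, inner_smul_right, inner_self_eq_norm_sq_to_K,
    Complex.conj_ofReal, Complex.re_ofReal_mul, Complex.add_re, Complex.re_ofReal_mul]
  have h3 : 0 ≤ (((‖A ⟨R l x, h⟩‖ : ℝ) : ℂ) ^ 2).re := by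
    rw [← Complex.ofReal_pow, Complex.ofReal_re]; positivity
  exact mul_nonneg hl.le (add_nonneg (mul_nonneg hl.le h1) h3)

/-- A vector orthogonal to the domain can be written `u + A u`; pairing it with `u` itself gives
`‖u‖² + Re ⟨A u, u⟩ = 0`, hence `u = 0`. -/
lemma IsMaximalAccretive.dense_domain [CompleteSpace X] (hA : IsMaximalAccretive A) :
    Dense (A.domain : Set X) := by
  rw [Submodule.dense_iff_topologicalClosure_eq_top, Submodule.topologicalClosure_eq_top_iff,
    Submodule.eq_bot_iff]
  intro z hz
  obtain ⟨u, rfl⟩ := hA.surjective 1 one_pos z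
  have h1 := (Submodule.mem_orthogonal' _ _).1 hz u u.2
  have h2 := hA.re_inner_nonneg u
  have h3 : (inner ℂ (((1 : ℝ) : ℂ) • (u : X) + A u) (u : X)).re
      = ‖(u : X)‖ ^ 2 + (inner ℂ (A u) (u : X)).re := by
    rw [inner_add_left, inner_smul_left, inner_self_eq_norm_sq_to_K]
    simp [← Complex.ofReal_pow]
  rw [h1, Complex.zero_re] at h3
  have h4 : ‖(u : X)‖ = 0 := by nlinarith [norm_nonneg (u : X)]
  have h5 : u = 0 := Subtype.ext (norm_eq_zero.1 h4)
  rw [h5]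
  simp

/-- Convergence on a dense set of a uniformly bounded family of operators extends to the whole
space. -/
lemma tendsto_of_dense_of_norm_le {ι Y : Type*} [NormedAddCommGroup Y] [NormedSpace ℂ Y]
    {l : Filter ι} {D : Set Y} (hD : Dense D)
    {L : ι → Y →L[ℂ] Y} (hL : ∀ᶠ i in l, ∀ x, ‖L i x‖ ≤ ‖x‖)
    (h : ∀ x ∈ D, Tendsto (fun i => L i x) l (𝓝 x)) (x : Y) :
    Tendsto (fun i => L i x) l (𝓝 x) := by
  rw [Metric.tendsto_nhds]
  intro ε hε
  obtain ⟨y, hy, hxy⟩ := hD.exists_dist_lt x (show 0 < ε / 3 by positivity)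
  filter_upwards [hL, (Metric.tendsto_nhds.1 (h y hy)) (ε / 3) (by positivity)] with i h1 h2
  have h3 : dist (L i x) (L i y) ≤ dist x y := by
    rw [dist_eq_norm, dist_eq_norm, ← map_sub]; exact h1 _
  linarith [dist_triangle4 (L i x) (L i y) y x, dist_comm y x]

/-- On the domain `l R l u - u = -R l (A u)` has norm at most `‖A u‖ / l`; density and the
contraction bound do the rest. -/
lemma IsResolvent.tendsto_smul [CompleteSpace X] (hR : IsResolvent A R) (hA : IsMaximalAccretive A)
    (x : X) : Tendsto (fun l : ℝ => (l : ℂ) • R l x) atTop (𝓝 x) := by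
  refine tendsto_of_dense_of_norm_le (L := fun l : ℝ => (l : ℂ) • R l) hA.dense_domain ?_ ?_ x
  · filter_upwards [eventually_gt_atTop 0] with l hl x
    simpa [norm_smul, abs_of_pos hl] using hR.mul_norm_le hA hl x
  · intro u hu
    rw [tendsto_iff_norm_sub_tendsto_zero]
    refine squeeze_zero' (Eventually.of_forall fun _ => norm_nonneg _) ?_
      (tendsto_const_nhds.div_atTop tendsto_id : Tendsto (fun l : ℝ => ‖A ⟨u, hu⟩‖ / l) atTop (𝓝 0))
    filter_upwards [eventually_gt_atTop 0] with l hl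
    have h1 := hR.apply_eq hA hl ⟨u, hu⟩
    rw [map_add, map_smul] at h1
    have h2 := hR.mul_norm_le hA hl (A ⟨u, hu⟩)
    have h3 : ((l : ℂ) • R l) u - u = -R l (A ⟨u, hu⟩) := by
      rw [smul_apply]
      nth_rewrite 2 [show u = _ from h1.symm]
      abel
    rw [h3, norm_neg, le_div_iff₀ hl, mul_comm]
    exact h2

lemma IsResolvent.tendsto_yosida [CompleteSpace X] (hR : IsResolvent A R)
    (hA : IsMaximalAccretive A) (u : A.domain) :
    Tendsto (fun l : ℝ => yosida R l u) atTop (𝓝 (A u)) := by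
  refine (hR.tendsto_smul hA (A u)).congr' ?_
  filter_upwards [eventually_gt_atTop 0] with l hl
  exact (hR.yosida_apply_mem hA hl u).symm

end MaximalAccretive

/-! ### Contraction semigroups of bounded accretive operators -/

lemma norm_le_of_antitoneOn {X : Type*} [SeminormedAddCommGroup X] {w : ℝ → X} (h : AntitoneOn (fun t => ‖w t‖ ^ 2) (Ici 0)) {t : ℝ}
    (ht : 0 ≤ t) : ‖w t‖ ≤ ‖w 0‖ :=
  le_of_sq_le_sq (h self_mem_Ici ht ht) (norm_nonneg _)

section BoundedAccretive

variable {X : Type*} [NormedAddCommGroup X] [InnerProductSpace ℂ X]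

/-- The energy estimate behind both contractivity and uniqueness: the derivative of `‖w‖²` is `2 Re
⟨w', w⟩`. Differentiability is only asked for at positive times, as in the notion of classical
solution. -/
lemma antitoneOn_norm_sq {w w' : ℝ → X} (hc : ContinuousOn w (Ici 0))
    (hd : ∀ t, 0 < t → HasDerivAt w (w' t) t)
    (h : ∀ t, 0 < t → (inner ℂ (w' t) (w t)).re ≤ 0) :
    AntitoneOn (fun t => ‖w t‖ ^ 2) (Ici 0) := by
  let _ : InnerProductSpace ℝ X := InnerProductSpace.complexToReal
  have hd' : ∀ t, 0 < t → HasDerivAt (fun t => ‖w t‖ ^ 2) (2 * inner ℝ (w t) (w' t)) t :=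
    fun t ht => (hd t ht).norm_sq
  refine antitoneOn_of_deriv_nonpos (convex_Ici 0) (hc.norm.pow 2) ?_ ?_
  · rw [interior_Ici]
    exact fun t ht => (hd' t ht).differentiableAt.differentiableWithinAt
  · rw [interior_Ici]
    intro t ht
    rw [(hd' t ht).deriv]
    have := h t ht
    rw [real_inner_comm]
    have e : inner ℝ (w' t) (w t) = (inner ℂ (w' t) (w t)).re := rfl
    rw [e]
    linarith

lemma HasDerivAt.clm_apply' {L : ℝ → X →L[ℂ] X} {L' : X →L[ℂ] X} {v : ℝ → X} {v' : X} {t : ℝ}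
    (hL : HasDerivAt L L' t) (hv : HasDerivAt v v' t) :
    HasDerivAt (fun s => L s (v s)) (L' (v t) + L t v') t := by
  have h1 : HasDerivAt (fun s => (L s).restrictScalars ℝ) (L'.restrictScalars ℝ) t :=
    (ContinuousLinearMap.restrictScalarsL ℂ X X ℝ ℝ).hasFDerivAt.comp_hasDerivAt t hL
  exact h1.clm_apply hv

variable [CompleteSpace X]

/-- The semigroup `exp(-t B)` of a bounded operator `B`. -/
noncomputable def expNeg (B : X →L[ℂ] X) (t : ℝ) : X →L[ℂ] X := NormedSpace.exp (t • -B)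

lemma expNeg_zero (B : X →L[ℂ] X) : expNeg B 0 = 1 := by simp [expNeg]

lemma expNeg_of_zero (t : ℝ) : expNeg (0 : X →L[ℂ] X) t = 1 := by simp [expNeg]

lemma expNeg_add (B : X →L[ℂ] X) (s t : ℝ) : expNeg B (s + t) = expNeg B s * expNeg B t := by
  let +nondep : NormedAlgebra ℚ (X →L[ℂ] X) := .restrictScalars ℚ ℂ _
  rw [expNeg, add_smul, NormedSpace.exp_add_of_commute, expNeg, expNeg]
  exact ((Commute.refl _).smul_left _).smul_right _

lemma Commute.expNeg_right {B C : X →L[ℂ] X} (h : Commute C B) (t : ℝ) :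
    Commute C (expNeg B t) :=
  (h.neg_right.smul_right t).exp_right

lemma hasDerivAt_expNeg (B : X →L[ℂ] X) (t : ℝ) : HasDerivAt (expNeg B) (-(B * expNeg B t)) t := by
  have := hasDerivAt_exp_smul_const' (𝕂 := ℝ) (-B) t
  rwa [neg_mul] at this

lemma hasDerivAt_expNeg_apply (B : X →L[ℂ] X) (t : ℝ) (x : X) :
    HasDerivAt (fun t => expNeg B t x) (-(B (expNeg B t x))) t := by
  simpa using (hasDerivAt_expNeg B t).clm_apply' (hasDerivAt_const t x)

lemma continuous_expNeg_apply (B : X →L[ℂ] X) (x : X) : Continuous fun t => expNeg B t x :=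
  continuous_iff_continuousAt.2 fun t => (hasDerivAt_expNeg_apply B t x).continuousAt

lemma norm_expNeg_apply_le {B : X →L[ℂ] X} (hB : ∀ x, 0 ≤ (inner ℂ (B x) x).re) {t : ℝ}
    (ht : 0 ≤ t) (x : X) : ‖expNeg B t x‖ ≤ ‖x‖ := by
  have h := antitoneOn_norm_sq (w := fun t => expNeg B t x)
    (continuous_expNeg_apply B x).continuousOn (fun t _ => hasDerivAt_expNeg_apply B t x)
    (fun t _ => by rw [inner_neg_left, Complex.neg_re]; linarith [hB (expNeg B t x)])
  simpa [expNeg_zero] using norm_le_of_antitoneOn h ht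

/-- Two commuting contraction semigroups are as close as their generators. -/
lemma norm_expNeg_sub_le {B C : X →L[ℂ] X} (hB : ∀ x, 0 ≤ (inner ℂ (B x) x).re)
    (hC : ∀ x, 0 ≤ (inner ℂ (C x) x).re) (hBC : Commute B C) {t : ℝ} (ht : 0 ≤ t) (x : X) :
    ‖expNeg B t x - expNeg C t x‖ ≤ ‖B x - C x‖ * t := by
  -- This curve joins `expNeg C t x` at `s = 0` to `expNeg B t x` at `s = t`. Commutation moves both
  -- generators onto `x`, so the speed is at most `‖C x - B x‖`.
  have hd : ∀ s, HasDerivAt (fun s => expNeg B s (expNeg C (t - s) x))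
      (expNeg B s (expNeg C (t - s) (C x - B x))) s := by
    intro s
    have h1 : HasDerivAt (fun s => expNeg C (t - s) x) (C (expNeg C (t - s) x)) s := by
      have := (hasDerivAt_expNeg_apply C (t - s) x).scomp s ((hasDerivAt_id s).const_sub t)
      simpa [Function.comp_def] using this
    refine ((hasDerivAt_expNeg B s).clm_apply' h1).congr_deriv ?_
    have c1 := congrArg (fun L => L (expNeg C (t - s) x)) ((Commute.refl B).expNeg_right s).eq
    have c2 := congrArg (fun L => L x) (hBC.expNeg_right (t - s)).eq
    have c3 := congrArg (fun L => L x) ((Commute.refl C).expNeg_right (t - s)).eq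
    simp only [mul_apply_eq_comp] at c1 c2 c3
    simp only [neg_apply, mul_apply_eq_comp, map_sub]
    rw [c1, c2, c3]
    abel
  have := Convex.norm_image_sub_le_of_norm_hasDerivWithin_le (s := Icc 0 t) (x := 0) (y := t)
    (C := ‖B x - C x‖) (fun s _ => (hd s).hasDerivWithinAt) ?_ (convex_Icc 0 t)
    (left_mem_Icc.2 ht) (right_mem_Icc.2 ht)
  · simpa [expNeg_zero, abs_of_nonneg ht] using this
  · intro s hs
    rw [norm_sub_rev (B x)]
    exact (norm_expNeg_apply_le hB hs.1 _).trans (norm_expNeg_apply_le hC (sub_nonneg.2 hs.2) _)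

end BoundedAccretive

/-! ### Generation of contraction semigroups -/

section Generation

variable {X : Type*} [NormedAddCommGroup X] [InnerProductSpace ℂ X] [CompleteSpace X]

/-- `T` is the strong limit of the semigroups generated by the Yosida approximations. -/
def IsYosidaLimit (R : ℝ → X →L[ℂ] X) (T : ℝ → X →L[ℂ] X) : Prop :=
  ∀ t, 0 ≤ t → ∀ x,
    Tendsto (fun n : ℕ => expNeg (yosida R (n + 1)) t x) atTop (𝓝 (T t x))

variable {A : X →ₗ.[ℂ] X} {R : ℝ → X →L[ℂ] X} {T : ℝ → X →L[ℂ] X}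

lemma tendsto_natCast_add_one : Tendsto (fun n : ℕ => (n : ℝ) + 1) atTop atTop :=
  tendsto_natCast_atTop_atTop.atTop_add tendsto_const_nhds

/-! ### Convergence of the exponentials of the Yosida approximations. -/

namespace IsResolvent

lemma norm_expNeg_yosida_le (hR : IsResolvent A R) (hA : IsMaximalAccretive A) (n : ℕ) {t : ℝ}
    (ht : 0 ≤ t) (x : X) : ‖expNeg (yosida R (n + 1)) t x‖ ≤ ‖x‖ :=
  norm_expNeg_apply_le (hR.re_inner_yosida_nonneg hA (by positivity)) ht x

/-- On the domain the exponentials are as close as the Yosida approximations, which converge there;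
an `ε / 3` argument with the contraction bound reaches every `x`. -/
lemma cauchySeq_expNeg_yosida (hR : IsResolvent A R) (hA : IsMaximalAccretive A) {t : ℝ}
    (ht : 0 ≤ t) (x : X) : CauchySeq fun n : ℕ => expNeg (yosida R (n + 1)) t x := by
  have hD : ∀ u : A.domain, CauchySeq fun n : ℕ => expNeg (yosida R (n + 1)) t (u : X) := by
    intro u
    have h1 := ((hR.tendsto_yosida hA u).comp tendsto_natCast_add_one).cauchySeq
    rw [Metric.cauchySeq_iff] at h1 ⊢
    intro ε hε
    -- The divisor is `t + 1` rather than `t` so that `t = 0` is allowed.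
    obtain ⟨N, hN⟩ := h1 (ε / (t + 1)) (by positivity)
    refine ⟨N, fun m hm n hn => ?_⟩
    have h2 := hN m hm n hn
    have h3 := norm_expNeg_sub_le (hR.re_inner_yosida_nonneg hA (by positivity : 0 < (m : ℝ) + 1))
      (hR.re_inner_yosida_nonneg hA (by positivity : 0 < (n : ℝ) + 1))
      (hR.yosida_commute hA (by positivity) (by positivity)) ht (u : X)
    simp only [Function.comp_apply, dist_eq_norm] at h2 ⊢
    rw [lt_div_iff₀ (by positivity)] at h2
    nlinarith [norm_nonneg (yosida R (m + 1) (u : X) - yosida R (n + 1) (u : X))]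
  rw [Metric.cauchySeq_iff]
  intro ε hε
  obtain ⟨u, hu, hxu⟩ := hA.dense_domain.exists_dist_lt x (show 0 < ε / 3 by positivity)
  obtain ⟨N, hN⟩ := Metric.cauchySeq_iff.1 (hD ⟨u, hu⟩) (ε / 3) (by positivity)
  refine ⟨N, fun m hm n hn => ?_⟩
  have h : ∀ k : ℕ, dist (expNeg (yosida R (k + 1)) t x) (expNeg (yosida R (k + 1)) t u)
      ≤ dist x u := fun k => by
    rw [dist_eq_norm, dist_eq_norm, ← map_sub]; exact hR.norm_expNeg_yosida_le hA k ht _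
  have h1 := dist_triangle4 (expNeg (yosida R (m + 1)) t x) (expNeg (yosida R (m + 1)) t u)
    (expNeg (yosida R (n + 1)) t u) (expNeg (yosida R (n + 1)) t x)
  rw [dist_comm (expNeg (yosida R (n + 1)) t u)] at h1
  linarith [h m, h n, hN m hm n hn]

lemma exists_isYosidaLimit (hR : IsResolvent A R) (hA : IsMaximalAccretive A) :
    ∃ T, IsYosidaLimit R T := by
  have : ∀ t, ∃ L : X →L[ℂ] X, 0 ≤ t → ∀ x,
      Tendsto (fun n : ℕ => expNeg (yosida R (n + 1)) t x) atTop (𝓝 (L x)) := by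
    intro t
    by_cases ht : 0 ≤ t
    · choose f hf using fun x => cauchySeq_tendsto_of_complete (hR.cauchySeq_expNeg_yosida hA ht x)
      -- A pointwise limit of bounded operators on a Banach space is bounded.
      exact ⟨continuousLinearMapOfTendsto (fun n : ℕ => expNeg (yosida R (n + 1)) t)
        (tendsto_pi_nhds.2 hf), fun _ => hf⟩
    · exact ⟨0, fun h => absurd h ht⟩
  choose T hT using this
  exact ⟨T, hT⟩

end IsResolvent

/-! ### The limit semigroup, its generator and its orbits. -/

namespace IsYosidaLimit

lemma norm_apply_le (hT : IsYosidaLimit R T) (hR : IsResolvent A R) (hA : IsMaximalAccretive A)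
    {t : ℝ} (ht : 0 ≤ t) (x : X) : ‖T t x‖ ≤ ‖x‖ :=
  le_of_tendsto (hT t ht x).norm
    (Eventually.of_forall fun n => hR.norm_expNeg_yosida_le hA n ht x)

lemma apply_zero (hT : IsYosidaLimit R T) (x : X) : T 0 x = x := by
  refine tendsto_nhds_unique (hT 0 le_rfl x) ?_
  simp only [expNeg_zero]
  exact tendsto_const_nhds

/-- The approximating semigroups may be applied to a convergent sequence. -/
lemma tendsto_apply (hT : IsYosidaLimit R T) (hR : IsResolvent A R) (hA : IsMaximalAccretive A)
    {t : ℝ} (ht : 0 ≤ t) {v : ℕ → X} {x : X} (hv : Tendsto v atTop (𝓝 x)) :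
    Tendsto (fun n : ℕ => expNeg (yosida R (n + 1)) t (v n)) atTop (𝓝 (T t x)) := by
  have h1 : Tendsto (fun n : ℕ => expNeg (yosida R (n + 1)) t (v n - x)) atTop (𝓝 0) := by
    refine squeeze_zero_norm (fun n => hR.norm_expNeg_yosida_le hA n ht _) ?_
    exact tendsto_iff_norm_sub_tendsto_zero.1 hv
  simpa using h1.add (hT t ht x)

lemma apply_add (hT : IsYosidaLimit R T) (hR : IsResolvent A R) (hA : IsMaximalAccretive A)
    {s t : ℝ} (hs : 0 ≤ s) (ht : 0 ≤ t) (x : X) : T (s + t) x = T s (T t x) := by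
  refine tendsto_nhds_unique (hT (s + t) (add_nonneg hs ht) x) ?_
  simp only [expNeg_add]
  exact hT.tendsto_apply hR hA hs (hT t ht x)

/-- Commutation passes from resolvents to Yosida approximations, to their exponentials and to the
limit. Since the values of `R l` lie in the domain, this is the tool for showing that vectors built
from the semigroup belong to it. -/
lemma resolvent_apply (hT : IsYosidaLimit R T) (hR : IsResolvent A R) (hA : IsMaximalAccretive A)
    {l t : ℝ} (hl : 0 < l) (ht : 0 ≤ t) (x : X) : R l (T t x) = T t (R l x) := by
  refine tendsto_nhds_unique (((R l).continuous.tendsto _).comp (hT t ht x))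
    ((hT t ht (R l x)).congr fun n => ?_)
  have h := (hR.commute_yosida hA hl (by positivity : 0 < (n : ℝ) + 1)).expNeg_right t
  exact congrArg (fun L => L x) h.eq.symm

/-- Compare the approximations with the trivial semigroup, generated by `0`, and pass to the limit.
-/
lemma norm_apply_sub_le (hT : IsYosidaLimit R T) (hR : IsResolvent A R)
    (hA : IsMaximalAccretive A) {t : ℝ} (ht : 0 ≤ t) (u : A.domain) :
    ‖T t u - u‖ ≤ ‖A u‖ * t := by
  refine le_of_tendsto_of_tendsto' ((hT t ht u).sub_const (u : X)).norm
    (((hR.tendsto_yosida hA u).comp tendsto_natCast_add_one).norm.mul_const t) fun n => ?_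
  have := norm_expNeg_sub_le (hR.re_inner_yosida_nonneg hA (by positivity : 0 < (n : ℝ) + 1))
    (C := 0) (by simp) (Commute.zero_right _) ht (u : X)
  simpa [expNeg_of_zero] using this

lemma tendsto_zero (hT : IsYosidaLimit R T) (hR : IsResolvent A R) (hA : IsMaximalAccretive A)
    (x : X) : Tendsto (fun t => T t x) (𝓝[≥] 0) (𝓝 x) := by
  refine tendsto_of_dense_of_norm_le hA.dense_domain ?_ (fun u hu => ?_) x
  · filter_upwards [self_mem_nhdsWithin] with t ht x using hT.norm_apply_le hR hA ht x
  · rw [tendsto_iff_norm_sub_tendsto_zero]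
    refine squeeze_zero' (g := fun t => ‖A ⟨u, hu⟩‖ * t)
      (Eventually.of_forall fun _ => norm_nonneg _) ?_ ?_
    · filter_upwards [self_mem_nhdsWithin] with t ht using hT.norm_apply_sub_le hR hA ht ⟨u, hu⟩
    · have : Tendsto (fun t => ‖A ⟨u, hu⟩‖ * t) (𝓝 0) (𝓝 (‖A ⟨u, hu⟩‖ * 0)) :=
        (continuous_const_mul _).tendsto 0
      rw [mul_zero] at this
      exact this.mono_left nhdsWithin_le_nhds

lemma norm_apply_sub_apply_le (hT : IsYosidaLimit R T) (hR : IsResolvent A R)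
    (hA : IsMaximalAccretive A) {s t : ℝ} (hs : 0 ≤ s) (ht : 0 ≤ t) (x : X) :
    ‖T t x - T s x‖ ≤ ‖T |t - s| x - x‖ := by
  wlog hst : s ≤ t generalizing s t
  · rw [norm_sub_rev, abs_sub_comm]
    exact this ht hs (le_of_not_ge hst)
  rw [abs_of_nonneg (sub_nonneg.2 hst)]
  have : T t x = T s (T (t - s) x) := by
    rw [← hT.apply_add hR hA hs (sub_nonneg.2 hst), add_sub_cancel]
  rw [this, ← map_sub]
  exact hT.norm_apply_le hR hA hs _

/-- The orbits of the semigroup, extended by a constant to negative times, are continuous. -/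
lemma continuous_orbit (hT : IsYosidaLimit R T) (hR : IsResolvent A R)
    (hA : IsMaximalAccretive A) (x : X) : Continuous fun t : ℝ => T (max t 0) x := by
  refine continuous_iff_continuousAt.2 fun s => ?_
  rw [ContinuousAt, tendsto_iff_norm_sub_tendsto_zero]
  refine squeeze_zero (fun _ => norm_nonneg _)
    (fun t => hT.norm_apply_sub_apply_le hR hA (le_max_right _ _) (le_max_right _ _) x) ?_
  have h1 : Tendsto (fun t : ℝ => |max t 0 - max s 0|) (𝓝 s) (𝓝[≥] 0) := by
    refine tendsto_nhdsWithin_iff.2 ⟨?_, Eventually.of_forall fun _ => mem_Ici.2 (abs_nonneg _)⟩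
    have : Continuous fun t : ℝ => |max t 0 - max s 0| := by fun_prop
    simpa using this.tendsto s
  simpa using (((hT.tendsto_zero hR hA x).comp h1).sub_const x).norm

/-- Integrate the equation of each approximation and pass to the limit. Dominated convergence
applies with the constant `‖A u‖`, because `yosida R l u = l R l (A u)`. The `max s 0` here and
below makes the orbit continuous on all of `ℝ` without affecting nonnegative times. -/
lemma apply_eq_sub_integral (hT : IsYosidaLimit R T) (hR : IsResolvent A R)
    (hA : IsMaximalAccretive A) {t : ℝ} (ht : 0 ≤ t) (u : A.domain) :
    T t u = u - ∫ s in (0 : ℝ)..t, T (max s 0) (A u) := by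
  have h1 : ∀ n : ℕ, ∫ s in (0 : ℝ)..t, expNeg (yosida R (n + 1)) s (yosida R (n + 1) u)
      = u - expNeg (yosida R (n + 1)) t u := by
    intro n
    have hd : ∀ s, HasDerivAt (fun s => -expNeg (yosida R (n + 1)) s (u : X))
        (expNeg (yosida R (n + 1)) s (yosida R (n + 1) u)) s := by
      intro s
      refine (hasDerivAt_expNeg_apply (yosida R (n + 1)) s (u : X)).neg.congr_deriv ?_
      rw [neg_neg]
      exact congrArg (fun L => L (u : X)) ((Commute.refl (yosida R (n + 1))).expNeg_right s).eq
    rw [intervalIntegral.integral_eq_sub_of_hasDerivAt (fun s _ => hd s)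
      ((continuous_expNeg_apply _ _).intervalIntegrable _ _), expNeg_zero]
    simp
    abel
  have hY : Tendsto (fun n : ℕ => yosida R (n + 1) (u : X)) atTop (𝓝 (A u)) :=
    (hR.tendsto_yosida hA u).comp tendsto_natCast_add_one
  have h2 : Tendsto
      (fun n : ℕ => ∫ s in (0 : ℝ)..t, expNeg (yosida R (n + 1)) s (yosida R (n + 1) u)) atTop
      (𝓝 (∫ s in (0 : ℝ)..t, T (max s 0) (A u))) := by
    refine intervalIntegral.tendsto_integral_filter_of_dominated_convergence (fun _ => ‖A u‖)
      (Eventually.of_forall fun n => (continuous_expNeg_apply _ _).aestronglyMeasurable)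
      (Eventually.of_forall fun n => Eventually.of_forall fun s hs => ?_)
      intervalIntegrable_const (Eventually.of_forall fun s hs => ?_)
    · rw [uIoc_of_le ht] at hs
      refine (hR.norm_expNeg_yosida_le hA n hs.1.le _).trans ?_
      have hn : 0 < (n : ℝ) + 1 := by positivity
      have h3 := hR.mul_norm_le hA hn (A u)
      rw [hR.yosida_apply_mem hA hn, norm_smul, Complex.norm_real, Real.norm_of_nonneg hn.le]
      exact h3
    · rw [uIoc_of_le ht] at hs
      rw [max_eq_left hs.1.le]
      exact hT.tendsto_apply hR hA hs.1.le hY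
  simp only [h1] at h2
  have h3 := tendsto_nhds_unique h2 ((hT t ht u).const_sub (u : X))
  rw [h3, sub_sub_cancel]

/-- For arbitrary `x`, smooth first: the integral formula holds for `R 1 x`, and `A (R 1 x) = x - R
1 x`. Pulling `R 1` out of the integral exhibits the integral of the orbit as a value of `R 1`. -/
lemma integral_mem_domain (hT : IsYosidaLimit R T) (hR : IsResolvent A R)
    (hA : IsMaximalAccretive A) {t : ℝ} (ht : 0 ≤ t) (x : X) :
    ∃ h : (∫ s in (0 : ℝ)..t, T (max s 0) x) ∈ A.domain, A ⟨_, h⟩ = x - T t x := by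
  obtain ⟨h, e⟩ := hR 1 one_pos x
  have e1 : A ⟨R 1 x, h⟩ = x - R 1 x := by
    rw [eq_sub_iff_add_eq']
    simpa using e
  have h1 := hT.apply_eq_sub_integral hR hA ht ⟨R 1 x, h⟩
  have hi : ∀ y, IntervalIntegrable (fun s => T (max s 0) y) volume 0 t := fun y =>
    (hT.continuous_orbit hR hA y).intervalIntegrable _ _
  simp only [e1, map_sub] at h1
  rw [intervalIntegral.integral_sub (hi x) (hi _)] at h1
  have h2 : ∫ s in (0 : ℝ)..t, T (max s 0) (R 1 x) = R 1 (∫ s in (0 : ℝ)..t, T (max s 0) x) := by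
    rw [← ContinuousLinearMap.intervalIntegral_comp_comm _ (hi x)]
    simp only [hT.resolvent_apply hR hA one_pos (le_max_right _ _)]
  rw [h2, ← hT.resolvent_apply hR hA one_pos ht] at h1
  have h3 : (∫ s in (0 : ℝ)..t, T (max s 0) x)
      = R 1 (x - T t x + ∫ s in (0 : ℝ)..t, T (max s 0) x) := by
    rw [map_add, map_sub, h1]
    abel
  obtain ⟨h4, e4⟩ := hR 1 one_pos (x - T t x + ∫ s in (0 : ℝ)..t, T (max s 0) x)
  simp only [← h3] at h4 e4
  refine ⟨h4, ?_⟩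
  rw [Complex.ofReal_one, one_smul, add_comm] at e4
  exact add_right_cancel e4

/-- Write `u = R 1 (u + A u)` and commute `R 1` with `T t`. -/
lemma apply_mem_domain (hT : IsYosidaLimit R T) (hR : IsResolvent A R)
    (hA : IsMaximalAccretive A) {t : ℝ} (ht : 0 ≤ t) (u : A.domain) :
    ∃ h : T t u ∈ A.domain, A ⟨_, h⟩ = T t (A u) := by
  have h1 := hR.apply_eq hA one_pos u
  obtain ⟨h2, e2⟩ := hR 1 one_pos (T t (((1 : ℝ) : ℂ) • (u : X) + A u))
  simp only [hT.resolvent_apply hR hA one_pos ht, h1] at h2 e2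
  refine ⟨h2, ?_⟩
  exact add_left_cancel (e2.trans (by rw [map_add, map_smul]))

lemma tendsto_average (hT : IsYosidaLimit R T) (hR : IsResolvent A R)
    (hA : IsMaximalAccretive A) (x : X) :
    Tendsto (fun t : ℝ => t⁻¹ • ∫ s in (0 : ℝ)..t, T (max s 0) x) (𝓝[>] 0) (𝓝 x) := by
  have h1 := (hT.continuous_orbit hR hA x).integral_hasStrictDerivAt 0 0
  have h2 := h1.hasDerivAt.hasDerivWithinAt (s := Ioi 0)
  rw [hasDerivWithinAt_iff_tendsto_slope' (by simp)] at h2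
  simpa [slope_fun_def, hT.apply_zero] using h2

lemma mem_graph_iff (hT : IsYosidaLimit R T) (hR : IsResolvent A R)
    (hA : IsMaximalAccretive A) (x y : X) :
    (x, y) ∈ (-A).graph ↔ Tendsto (fun t : ℝ => t⁻¹ • (T t x - x)) (𝓝[>] 0) (𝓝 y) := by
  rw [LinearPMap.mem_graph_iff]
  constructor
  · rintro ⟨u, rfl, rfl⟩
    refine (hT.tendsto_average hR hA (A u)).neg.congr' ?_
    filter_upwards [self_mem_nhdsWithin] with t ht
    rw [hT.apply_eq_sub_integral hR hA (le_of_lt ht) u, sub_sub_cancel_left, smul_neg]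
  · intro h
    have h1 : Tendsto (fun t : ℝ => R 1 (t⁻¹ • (∫ s in (0 : ℝ)..t, T (max s 0) x)
        - t⁻¹ • (T t x - x))) (𝓝[>] 0) (𝓝 (R 1 (x - y))) :=
      ((R 1).continuous.tendsto _).comp ((hT.tendsto_average hR hA x).sub h)
    -- With `I` the integral of the orbit up to `t`, `A I = x - T t x` gives `I = R 1 (I + x - T t
    -- x)`. Dividing by `t` and letting `t → 0⁺` puts `x` in the domain with `x + A x = x - y`.
    have h2 : x = R 1 (x - y) := by
      refine tendsto_nhds_unique (hT.tendsto_average hR hA x) (h1.congr' ?_)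
      filter_upwards [self_mem_nhdsWithin] with t ht
      obtain ⟨hd, e⟩ := hT.integral_mem_domain hR hA (le_of_lt ht) x
      rw [← smul_sub]
      have h3 := hR.apply_eq hA one_pos ⟨_, hd⟩
      rw [e, Complex.ofReal_one, one_smul] at h3
      have h4 : ∀ z, R 1 (t⁻¹ • z) = t⁻¹ • R 1 z := fun z =>
        ((R 1).restrictScalars ℝ).map_smul _ z
      rw [h4]
      congr 1
      refine Eq.trans ?_ h3
      congr 1
      change _ = (∫ s in (0 : ℝ)..t, T (max s 0) x) + _
      abel
    obtain ⟨h3, e⟩ := hR 1 one_pos (x - y)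
    simp only [← h2] at h3 e
    refine ⟨⟨x, h3⟩, rfl, ?_⟩
    rw [LinearPMap.neg_apply]
    simp only [Complex.ofReal_one, one_smul] at e
    exact neg_eq_iff_eq_neg.2 (add_left_cancel (e.trans (sub_eq_add_neg x y)))

lemma hasDerivWithinAt_apply (hT : IsYosidaLimit R T) (hR : IsResolvent A R)
    (hA : IsMaximalAccretive A) (u : A.domain) {t : ℝ} (ht : 0 ≤ t) :
    HasDerivWithinAt (fun t => T (max t 0) u) (-T t (A u)) (Ici 0) t := by
  have h1 := ((hT.continuous_orbit hR hA (A u)).integral_hasStrictDerivAt 0 t).hasDerivAt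
  rw [max_eq_left ht] at h1
  refine (h1.const_sub (u : X)).hasDerivWithinAt.congr (fun s hs => ?_) ?_
  · rw [max_eq_left hs, hT.apply_eq_sub_integral hR hA hs]
  · rw [max_eq_left ht, hT.apply_eq_sub_integral hR hA ht]

end IsYosidaLimit

/-! ### Uniqueness of classical and mild solutions. -/

omit [CompleteSpace X] in
lemma IsClassicalSolution.eqOn_zero (hA : IsMaximalAccretive A) {w : ℝ → X}
    (hw : IsClassicalSolution A 0 w) : EqOn w 0 (Ici 0) := by
  choose h hd using hw.hasDerivAt
  intro t ht
  have h1 := antitoneOn_norm_sq hw.continuousOn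
    (w' := fun t => if ht : 0 < t then -A ⟨w t, h t ht⟩ else 0)
    (fun t ht => by simpa [ht] using hd t ht) (fun t ht => by
      have := hA.re_inner_nonneg ⟨w t, h t ht⟩
      simpa [ht] using this)
  have h2 := norm_le_of_antitoneOn h1 ht
  rw [hw.initial, norm_zero] at h2
  exact norm_le_zero_iff.1 h2

omit [CompleteSpace X] in
lemma IsClassicalSolution.eqOn (hA : IsMaximalAccretive A) {U₀ : X} {U V : ℝ → X}
    (hU : IsClassicalSolution A U₀ U) (hV : IsClassicalSolution A U₀ V) : EqOn V U (Ici 0) := by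
  have : IsClassicalSolution A 0 fun t => V t - U t := by
    refine ⟨hV.continuousOn.sub hU.continuousOn, by rw [hV.initial, hU.initial, sub_self],
      fun t ht => ?_⟩
    obtain ⟨h1, d1⟩ := hV.hasDerivAt t ht
    obtain ⟨h2, d2⟩ := hU.hasDerivAt t ht
    refine ⟨A.domain.sub_mem h1 h2, (d1.sub d2).congr_deriv ?_⟩
    rw [← neg_sub', ← A.map_sub]
    rfl
  exact fun t ht => sub_eq_zero.1 (this.eqOn_zero hA ht)

/-- The primitive of the difference of two mild solutions is a classical solution starting from `0`,
so it vanishes. The difference itself is `-A` of that primitive, hence zero. -/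
lemma IsMildSolution.eqOn (hA : IsMaximalAccretive A) {U₀ : X} {U V : ℝ → X}
    (hU : IsMildSolution A U₀ U) (hV : IsMildSolution A U₀ V) : EqOn V U (Ici 0) := by
  have hi : ∀ {W : ℝ → X}, ContinuousOn W (Ici 0) → ∀ t, 0 ≤ t →
      IntervalIntegrable W volume 0 t := fun hW t ht =>
    (hW.mono (by rw [uIcc_of_le ht]; exact Icc_subset_Ici_self)).intervalIntegrable
  have key : ∀ t, 0 ≤ t → ∃ h : (∫ s in (0 : ℝ)..t, (V s - U s)) ∈ A.domain,
      V t - U t = -A ⟨_, h⟩ := by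
    intro t ht
    obtain ⟨h1, e1⟩ := hV.eq_sub t ht
    obtain ⟨h2, e2⟩ := hU.eq_sub t ht
    have e := intervalIntegral.integral_sub (hi hV.continuousOn t ht) (hi hU.continuousOn t ht)
    refine ⟨e ▸ A.domain.sub_mem h1 h2, ?_⟩
    rw [e1, e2, sub_sub_sub_cancel_left, ← neg_sub, ← A.map_sub]
    congr 2
    exact Subtype.ext e.symm
  have hc : ContinuousOn (fun t => V t - U t) (Ici 0) := hV.continuousOn.sub hU.continuousOn
  have hw : IsClassicalSolution A 0 fun t => ∫ s in (0 : ℝ)..t, (V s - U s) := by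
    refine ⟨?_, by simp, fun t ht => ?_⟩
    · intro t ht
      -- The interval reaches to `t + 1` so that it is a neighbourhood of `t` within `[0, ∞)`.
      have h1 := intervalIntegral.continuousOn_primitive_interval'
        (hi hc (t + 1) (add_nonneg ht zero_le_one)) left_mem_uIcc
      rw [uIcc_of_le (add_nonneg ht zero_le_one)] at h1
      refine (h1 t ⟨ht, by linarith⟩).mono_of_mem_nhdsWithin ?_
      rw [← Ici_inter_Iic]
      exact inter_mem self_mem_nhdsWithin (mem_nhdsWithin_of_mem_nhds (Iic_mem_nhds (by linarith)))
    · obtain ⟨h, e⟩ := key t ht.le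
      refine ⟨h, ?_⟩
      rw [← e]
      exact intervalIntegral.integral_hasDerivAt_right (hi hc t ht.le)
        (ContinuousOn.stronglyMeasurableAtFilter isOpen_Ioi (hc.mono Ioi_subset_Ici_self) t ht)
        (hc.continuousAt (Ici_mem_nhds ht))
  intro t ht
  obtain ⟨h, e⟩ := key t ht
  have h0 : (⟨_, h⟩ : A.domain) = 0 := Subtype.ext (hw.eqOn_zero hA ht)
  rw [h0, A.map_zero, neg_zero] at e
  exact sub_eq_zero.1 e

/-- A maximal accretive operator `A` on a Hilbert space generates, up to sign, a contraction
semigroup, whose orbits are the mild, respectively classical, solutions of `∂ₜU + A U = 0`. -/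
theorem IsMaximalAccretive.wellPosed (hA : IsMaximalAccretive A) :
    ∃ T : ℝ≥0 → X →L[ℂ] X,
      IsC0Semigroup T ∧ (∀ t, ‖T t‖ ≤ 1) ∧ IsGenerator (-A) T ∧
      ∀ U₀ : X, ∃ U : ℝ → X,
        (∀ t : ℝ≥0, U t = T t U₀) ∧
        IsMildSolution A U₀ U ∧
        (∀ V, IsMildSolution A U₀ V → EqOn V U (Ici 0)) ∧
        (∀ t, 0 ≤ t → ‖U t‖ ≤ ‖U₀‖) ∧
        ∀ h₀ : U₀ ∈ A.domain,
          IsClassicalSolution A U₀ U ∧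
          (∀ V, IsClassicalSolution A U₀ V → EqOn V U (Ici 0)) ∧
          IsC1 U ∧
          ContinuousIntoDomain A U ∧
          ∀ t, 0 ≤ t → ‖timeDeriv U t‖ ≤ ‖A ⟨U₀, h₀⟩‖ := by
  obtain ⟨R, hR⟩ := hA.exists_resolvent
  obtain ⟨T, hT⟩ := hR.exists_isYosidaLimit hA
  have hcoe : Tendsto ((↑) : ℝ≥0 → ℝ) (𝓝 0) (𝓝[≥] 0) :=
    tendsto_nhdsWithin_iff.2 ⟨NNReal.continuous_coe.tendsto 0, Eventually.of_forall fun t => t.2⟩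
  refine ⟨fun t => T t, ⟨?_, fun s t => ?_, fun x => (hT.tendsto_zero hR hA x).comp hcoe⟩,
    fun t => ?_, fun x y => ?_, fun U₀ => ⟨fun t => T (max t 0) U₀, fun t => ?_, ?_⟩⟩
  · ext x
    exact hT.apply_zero x
  · ext x
    exact hT.apply_add hR hA s.2 t.2 x
  · exact ContinuousLinearMap.opNorm_le_bound _ zero_le_one fun x => by
      rw [one_mul]; exact hT.norm_apply_le hR hA t.2 x
  · rw [hT.mem_graph_iff hR hA]
    constructor
    · intro h
      refine h.comp (tendsto_nhdsWithin_iff.2 ⟨?_, ?_⟩)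
      · exact (NNReal.continuous_coe.tendsto 0).mono_left nhdsWithin_le_nhds
      · filter_upwards [self_mem_nhdsWithin] with t ht
        exact_mod_cast ht
    · intro h
      have h1 : Tendsto Real.toNNReal (𝓝[>] 0) (𝓝[>] 0) := by
        refine tendsto_nhdsWithin_iff.2 ⟨?_, ?_⟩
        · have := (continuous_real_toNNReal.tendsto 0).mono_left
            (nhdsWithin_le_nhds (s := Ioi (0 : ℝ)))
          rwa [Real.toNNReal_zero] at this
        · filter_upwards [self_mem_nhdsWithin] with t ht
          exact Real.toNNReal_pos.2 ht
      refine (h.comp h1).congr' ?_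
      filter_upwards [self_mem_nhdsWithin] with t ht
      simp only [Function.comp_apply, Real.coe_toNNReal t (le_of_lt ht)]
  · simp
  have hmild : IsMildSolution A U₀ fun t => T (max t 0) U₀ := by
    refine ⟨(hT.continuous_orbit hR hA U₀).continuousOn, fun t ht => ?_⟩
    obtain ⟨h, e⟩ := hT.integral_mem_domain hR hA ht U₀
    refine ⟨h, ?_⟩
    rw [e, sub_sub_cancel, max_eq_left ht]
  refine ⟨hmild, fun V hV => hmild.eqOn hA hV,
    fun t _ => hT.norm_apply_le hR hA (le_max_right _ _) U₀, fun h₀ => ?_⟩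
  have hderiv := fun t (ht : 0 ≤ t) => hT.hasDerivWithinAt_apply hR hA ⟨U₀, h₀⟩ ht
  have hclass : IsClassicalSolution A U₀ fun t => T (max t 0) U₀ := by
    refine ⟨(hT.continuous_orbit hR hA U₀).continuousOn, by simp [hT.apply_zero],
      fun t ht => ?_⟩
    obtain ⟨h, e⟩ := hT.apply_mem_domain hR hA (le_max_right t 0) ⟨U₀, h₀⟩
    refine ⟨h, ?_⟩
    rw [e, max_eq_left ht.le]
    exact (hderiv t ht.le).hasDerivAt (Ici_mem_nhds ht)
  have hd : ∀ t, 0 ≤ t → derivWithin (fun t => T (max t 0) U₀) (Ici 0) t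
      = -T (max t 0) (A ⟨U₀, h₀⟩) := fun t ht => by
    rw [max_eq_left ht]
    exact (hderiv t ht).derivWithin (uniqueDiffOn_Ici 0 t ht)
  refine ⟨hclass, fun V hV => hclass.eqOn hA hV, ?_, ?_, fun t ht => ?_⟩
  · refine (contDiffOn_one_iff_derivWithin (uniqueDiffOn_Ici 0)).2
      ⟨fun t ht => (hderiv t ht).differentiableWithinAt, ?_⟩
    exact (hT.continuous_orbit hR hA (A ⟨U₀, h₀⟩)).neg.continuousOn.congr hd
  · choose h e using fun t : ℝ≥0 => hT.apply_mem_domain hR hA (le_max_right (t : ℝ) 0) ⟨U₀, h₀⟩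
    refine ⟨h, ?_⟩
    simp only [e]
    exact ((hT.continuous_orbit hR hA U₀).comp NNReal.continuous_coe).prodMk
      ((hT.continuous_orbit hR hA (A ⟨U₀, h₀⟩)).comp NNReal.continuous_coe)
  · rw [timeDeriv, hd t ht, norm_neg]
    exact hT.norm_apply_le hR hA (le_max_right _ _) _

end Generation

/-! ### Maximal accretivity of accretive perturbations of skew-adjoint operators. -/

section SkewAdjoint

variable {X : Type*} [NormedAddCommGroup X] [InnerProductSpace ℂ X] [CompleteSpace X]

/-- The sum of a skew-adjoint operator and of an everywhere defined accretive operator `K` with an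
everywhere defined adjoint `K'` is maximal accretive. -/
theorem isMaximalAccretive_of_skewAdjoint {A : X →ₗ.[ℂ] X} {K K' : X → X}
    (hadj : ∀ x y, inner ℂ (K x) y = inner ℂ x (K' y))
    (hK : ∀ x, 0 ≤ (inner ℂ (K x) x).re)
    -- This says that the graph of `A - K` is exactly that of minus its adjoint.
    (hA : ∀ u f, (u, f) ∈ A.graph ↔
      ∀ w : A.domain, inner ℂ (A w - K w) u = -inner ℂ (w : X) (f - K u)) :
    IsMaximalAccretive A := by
  have hskew : ∀ u : A.domain, (inner ℂ (A u - K u) (u : X)).re = 0 := by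
    intro u
    have h1 := (hA u (A u)).1 (A.mem_graph u) u
    have h2 := congrArg Complex.re h1
    rw [Complex.neg_re, ← inner_conj_symm, Complex.conj_re] at h2
    rw [← inner_conj_symm, Complex.conj_re]
    linarith
  have hacc : ∀ u : A.domain, 0 ≤ (inner ℂ (A u) (u : X)).re := by
    intro u
    have h1 := hskew u
    rw [inner_sub_left, Complex.sub_re] at h1
    linarith [hK u]
  have hadj' : ∀ x y, inner ℂ (K' x) y = inner ℂ x (K y) := fun x y => by
    rw [← inner_conj_symm, ← hadj, inner_conj_symm]
  have hclosed : IsClosed (A.graph : Set (X × X)) := by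
    -- Moving `K` onto `w` through `K'` turns each condition into a closed one in `(u, f)`, without
    -- any continuity of `K`.
    have : (A.graph : Set (X × X)) = ⋂ w : A.domain,
        {p : X × X | inner ℂ (A w - K w) p.1 = -(inner ℂ (w : X) p.2 - inner ℂ (K' w) p.1)} := by
      ext ⟨u, f⟩
      simp only [SetLike.mem_coe, hA, inner_sub_right, mem_iInter, mem_ofPred_eq, hadj']
    rw [this]
    exact isClosed_iInter fun w => isClosed_eq (by fun_prop) (by fun_prop)
  refine ⟨hacc, fun l hl f => ?_⟩
  have hbound : ∀ u : A.domain, l * ‖(u : X)‖ ≤ ‖(l : ℂ) • (u : X) + A u‖ := fun u =>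
    mul_norm_le_norm_smul_add l (hacc u)
  -- On its graph, `l + A` becomes a bounded operator. The graph norm is the maximum of `‖u‖ ≤ l⁻¹
  -- ‖L u‖` and `‖A u‖ ≤ ‖L u‖ + l ‖u‖ ≤ 2 ‖L u‖`, hence the constant `max l⁻¹ 2` and the closed
  -- range.
  let L : A.graph →L[ℂ] X := (((l : ℂ) • ContinuousLinearMap.fst ℂ X X)
    + ContinuousLinearMap.snd ℂ X X).comp A.graph.subtypeL
  have hL : ∀ p : A.graph, L p = (l : ℂ) • p.1.1 + p.1.2 := fun p => rfl
  have : CompleteSpace A.graph := hclosed.completeSpace_coe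
  have hLc : IsClosed (L.range : Set X) := by
    refine (ContinuousLinearMap.antilipschitz_of_bound L
      (K := ⟨max l⁻¹ 2, le_max_of_le_right zero_le_two⟩) fun p => ?_).isClosed_range
      L.uniformContinuous
    obtain ⟨⟨x, y⟩, hp⟩ := p
    obtain ⟨u, rfl, rfl⟩ := (LinearPMap.mem_graph_iff A).1 hp
    have h1 := hbound u
    rw [hL]
    change ‖((u : X), A u)‖ ≤ max l⁻¹ 2 * ‖(l : ℂ) • (u : X) + A u‖
    have h2 : ‖A u‖ ≤ 2 * ‖(l : ℂ) • (u : X) + A u‖ := by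
      have h3 := norm_sub_le ((l : ℂ) • (u : X) + A u) ((l : ℂ) • (u : X))
      rw [add_sub_cancel_left, norm_smul, Complex.norm_real, Real.norm_of_nonneg hl.le] at h3
      linarith
    refine max_le ?_ (h2.trans (by gcongr; exact le_max_right _ _))
    refine le_trans ?_ (mul_le_mul_of_nonneg_right (le_max_left l⁻¹ 2) (norm_nonneg _))
    rwa [inv_mul_eq_div, le_div_iff₀ hl, mul_comm]
  have hLd : L.range = ⊤ := by
    rw [← hLc.submodule_topologicalClosure_eq, Submodule.topologicalClosure_eq_top_iff,
      Submodule.eq_bot_iff]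
    intro v hv
    have h1 : ∀ w : A.domain, inner ℂ ((l : ℂ) • (w : X) + A w) v = 0 := fun w =>
      (Submodule.mem_orthogonal _ _).1 hv _ ⟨⟨_, A.mem_graph w⟩, rfl⟩
    -- Orthogonality to the range is the weak form of `(A - K) v = l v + K' v`, so `v` lies in the
    -- domain. Pairing with `v` kills the skew part and leaves `l ‖v‖² + Re ⟨K v, v⟩ = 0`.
    have h2 : (v, (l : ℂ) • v + K' v + K v) ∈ A.graph := by
      refine (hA _ _).2 fun w => ?_
      have h3 := h1 w
      rw [inner_add_left, inner_smul_left, Complex.conj_ofReal] at h3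
      rw [add_sub_cancel_right, inner_add_right, inner_smul_right, ← hadj, inner_sub_left,
        ← sub_eq_zero, ← h3]
      ring
    obtain ⟨u, rfl, hu⟩ := (LinearPMap.mem_graph_iff A).1 h2
    have h3 := hskew u
    rw [hu, add_sub_cancel_right, inner_add_left, inner_smul_left, Complex.conj_ofReal, hadj',
      inner_self_eq_norm_sq_to_K, ← inner_conj_symm, Complex.add_re, Complex.conj_re] at h3
    have h4 := hK u
    have h5 : (((l : ℝ) : ℂ) * ((‖(u : X)‖ : ℝ) : ℂ) ^ 2).re = l * ‖(u : X)‖ ^ 2 := by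
      simp [← Complex.ofReal_pow]
    have h6 : l * ‖(u : X)‖ ^ 2 = 0 := by
      have h7 : 0 ≤ l * ‖(u : X)‖ ^ 2 := by positivity
      have h8 := h5.symm.trans_le (le_of_le_of_eq (le_add_of_nonneg_right h4) h3)
      linarith
    rcases mul_eq_zero.1 h6 with h | h
    · exact absurd h hl.ne'
    · exact norm_eq_zero.1 (pow_eq_zero_iff two_ne_zero |>.1 h)
  have hf : f ∈ L.range := by rw [hLd]; exact Submodule.mem_top
  obtain ⟨⟨⟨x, y⟩, hp⟩, rfl⟩ := hf
  obtain ⟨u, rfl, rfl⟩ := (LinearPMap.mem_graph_iff A).1 hp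
  exact ⟨u, rfl⟩

end SkewAdjoint

/-! ### Green's formula for the curl -/

section Green

/-- The sesquilinear form `(v, w) ↦ conj (v k) * w i` on `ℂ³`. -/
noncomputable def coordForm (k i : Fin 3) : C3 →L[ℝ] C3 →L[ℝ] ℂ :=
  (ContinuousLinearMap.mul ℝ ℂ).bilinearComp
    ((Complex.conjCLE : ℂ →L[ℝ] ℂ).comp ((EuclideanSpace.proj k : C3 →L[ℂ] ℂ).restrictScalars ℝ))
    ((EuclideanSpace.proj i : C3 →L[ℂ] ℂ).restrictScalars ℝ)

lemma coordForm_apply (k i : Fin 3) (v w : C3) :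
    coordForm k i v w = (starRingEnd ℂ) (v k) * w i := rfl

lemma integral_sub_add_sub_add_sub {f₁ f₂ f₃ f₄ f₅ f₆ : R3 → ℂ} (h₁ : Integrable f₁)
    (h₂ : Integrable f₂) (h₃ : Integrable f₃) (h₄ : Integrable f₄) (h₅ : Integrable f₅)
    (h₆ : Integrable f₆) :
    ∫ x, (f₁ x - f₂ x + (f₃ x - f₄ x) + (f₅ x - f₆ x)) = (∫ x, f₁ x) - (∫ x, f₂ x)
      + ((∫ x, f₃ x) - ∫ x, f₄ x) + ((∫ x, f₅ x) - ∫ x, f₆ x) := by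
  have h12 : Integrable fun x => f₁ x - f₂ x := h₁.sub h₂
  have h34 : Integrable fun x => f₃ x - f₄ x := h₃.sub h₄
  have h56 : Integrable fun x => f₅ x - f₆ x := h₅.sub h₆
  have h14 : Integrable fun x => f₁ x - f₂ x + (f₃ x - f₄ x) := h12.add h34
  rw [integral_add h14 h56, integral_add h12 h34, integral_sub h₁ h₂, integral_sub h₃ h₄,
    integral_sub h₅ h₆]

variable {Ω : Set R3}

lemma IsTestField.integrable_coordForm {φ ψ : R3 → C3} (hφ : Continuous φ) (hψ : Continuous ψ)
    (hc : HasCompactSupport φ ∨ HasCompactSupport ψ) (k i : Fin 3) :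
    Integrable fun x => coordForm k i (φ x) (ψ x) := by
  refine Continuous.integrable_of_hasCompactSupport ?_ ?_
  · exact ((coordForm k i).continuous.comp hφ).clm_apply hψ
  · rcases hc with hc | hc
    · refine HasCompactSupport.intro hc fun x hx => ?_
      rw [image_eq_zero_of_notMem_tsupport hx]; simp
    · refine HasCompactSupport.intro hc fun x hx => ?_
      rw [image_eq_zero_of_notMem_tsupport hx]; simp

lemma IsTestField.continuous_fderiv_apply {φ : R3 → C3} (hφ : IsTestField Ω φ) (v : R3) :
    Continuous fun x => fderiv ℝ φ x v :=
  (hφ.smooth.continuous_fderiv (by simp)).clm_apply continuous_const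

/-- Green's formula for two test fields. -/
lemma IsTestField.integral_inner_curl {φ ψ : R3 → C3} (hφ : IsTestField Ω φ)
    (hψ : IsTestField Ω ψ) :
    ∫ x in Ω, inner ℂ (classicalCurl φ x) (ψ x) = ∫ x in Ω, inner ℂ (φ x) (classicalCurl ψ x) := by
  have hz : ∀ {χ : R3 → C3}, IsTestField Ω χ → ∀ x, x ∉ Ω → χ x = 0 := fun h x hx =>
    image_eq_zero_of_notMem_tsupport fun hh => hx (h.tsupport_subset hh)
  -- Both integrands vanish off `Ω`, so the integrations by parts take place on the whole space,
  -- without boundary terms.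
  rw [setIntegral_eq_integral_of_forall_compl_eq_zero fun x hx => by
      rw [hz hψ x hx, inner_zero_right],
    setIntegral_eq_integral_of_forall_compl_eq_zero fun x hx => by
      rw [hz hφ x hx, inner_zero_left]]
  let e : Fin 3 → R3 := fun j => EuclideanSpace.single j 1
  have ha : ∀ j k i, Integrable fun x => coordForm k i (fderiv ℝ φ x (e j)) (ψ x) := fun j k i =>
    integrable_coordForm (hφ.continuous_fderiv_apply _) hψ.smooth.continuous
      (Or.inr hψ.hasCompactSupport) k i
  have hb : ∀ j k i, Integrable fun x => coordForm k i (φ x) (fderiv ℝ ψ x (e j)) := fun j k i =>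
    integrable_coordForm hφ.smooth.continuous (hψ.continuous_fderiv_apply _)
      (Or.inl hφ.hasCompactSupport) k i
  have key : ∀ j k i, ∫ x, coordForm k i (φ x) (fderiv ℝ ψ x (e j))
      = -∫ x, coordForm k i (fderiv ℝ φ x (e j)) (ψ x) := fun j k i =>
    integral_bilinear_fderiv_right_eq_neg_left_of_integrable (ha j k i) (hb j k i)
      (integrable_coordForm hφ.smooth.continuous hψ.smooth.continuous
        (Or.inl hφ.hasCompactSupport) k i)
      (fun x _ => hφ.smooth.differentiable (by simp) x)
      (fun x _ => hψ.smooth.differentiable (by simp) x)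
  have e1 : ∀ x, inner ℂ (classicalCurl φ x) (ψ x)
      = (coordForm 2 0 (fderiv ℝ φ x (e 1)) (ψ x) - coordForm 1 0 (fderiv ℝ φ x (e 2)) (ψ x))
      + (coordForm 0 1 (fderiv ℝ φ x (e 2)) (ψ x) - coordForm 2 1 (fderiv ℝ φ x (e 0)) (ψ x))
      + (coordForm 1 2 (fderiv ℝ φ x (e 0)) (ψ x)
        - coordForm 0 2 (fderiv ℝ φ x (e 1)) (ψ x)) := by
    intro x
    simp only [PiLp.inner_apply, Fin.sum_univ_three, coordForm_apply, classicalCurl, partialDeriv, e]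
    simp
    ring
  have e2 : ∀ x, inner ℂ (φ x) (classicalCurl ψ x)
      = (coordForm 0 2 (φ x) (fderiv ℝ ψ x (e 1)) - coordForm 0 1 (φ x) (fderiv ℝ ψ x (e 2)))
      + (coordForm 1 0 (φ x) (fderiv ℝ ψ x (e 2)) - coordForm 1 2 (φ x) (fderiv ℝ ψ x (e 0)))
      + (coordForm 2 1 (φ x) (fderiv ℝ ψ x (e 0))
        - coordForm 2 0 (φ x) (fderiv ℝ ψ x (e 1))) := by
    intro x
    simp only [PiLp.inner_apply, Fin.sum_univ_three, coordForm_apply, classicalCurl, partialDeriv, e]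
    simp
    ring
  simp only [e1, e2]
  rw [integral_sub_add_sub_add_sub (ha _ _ _) (ha _ _ _) (ha _ _ _) (ha _ _ _) (ha _ _ _)
      (ha _ _ _),
    integral_sub_add_sub_add_sub (hb _ _ _) (hb _ _ _) (hb _ _ _) (hb _ _ _) (hb _ _ _)
      (hb _ _ _)]
  simp only [key]
  ring

lemma IsTestField.isL2Curl {φ : R3 → C3} (hφ : IsTestField Ω φ) :
    IsL2Curl Ω φ (classicalCurl φ) :=
  ⟨hφ.memLp, hφ.memLp_curl, fun _ hψ => hψ.integral_inner_curl hφ⟩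

lemma IsTestField.memHCurlZero (hΩ : IsOpen Ω) {φ : R3 → C3} (hφ : IsTestField Ω φ) :
    MemHCurlZero Ω φ := by
  refine ⟨⟨_, hφ.isL2Curl⟩, fun δ hδ => ⟨φ, hφ, by simpa using hδ, ?_⟩⟩
  rw [eLpNorm_congr_ae ((weakCurl_ae_eq hΩ hφ.isL2Curl).sub (ae_eq_refl (classicalCurl φ)))]
  simpa using hδ

lemma MeasureTheory.MemLp.inner_toLp {μ : Measure R3} {f g : R3 → C3} (hf : MemLp f 2 μ)
    (hg : MemLp g 2 μ) : inner ℂ (hf.toLp f) (hg.toLp g) = ∫ x, inner ℂ (f x) (g x) ∂μ := by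
  rw [L2.inner_def]
  refine integral_congr_ae ?_
  filter_upwards [hf.coeFn_toLp, hg.coeFn_toLp] with x h1 h2
  rw [h1, h2]

lemma MeasureTheory.MemLp.norm_toLp_sub_lt {μ : Measure R3} {f g : R3 → C3} (hf : MemLp f 2 μ)
    (hg : MemLp g 2 μ) {δ : ℝ} : ‖hf.toLp f - hg.toLp g‖ < δ ↔
      eLpNorm (f - g) 2 μ < ENNReal.ofReal δ := by
  rw [← MemLp.toLp_sub, Lp.norm_toLp, ENNReal.lt_ofReal_iff_toReal_lt (hf.sub hg).2.ne]

/-- Green's formula for fields of `H₀(curl; Ω)` and of `H(curl; Ω)`. -/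
lemma MemHCurlZero.integral_inner_curl {e b c : R3 → C3} (he : MemHCurlZero Ω e)
    (hb : IsL2Curl Ω b c) :
    ∫ x in Ω, inner ℂ (weakCurl Ω e x) (b x) = ∫ x in Ω, inner ℂ (e x) (c x) := by
  have hw := isL2Curl_weakCurl he.1
  -- Test fields converge to `e` in the graph norm; for each of them the formula is the definition
  -- of the weak curl of `b`, and both sides are continuous in `L²`.
  choose φ hφ h1 h2 using fun n : ℕ => he.2 (ENNReal.ofReal (1 / ((n : ℝ) + 1)))
    (ENNReal.ofReal_pos.2 (by positivity))
  have t1 : Tendsto (fun n => (hφ n).memLp.toLp (φ n)) atTop (𝓝 (hw.memLp.toLp e)) := by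
    rw [tendsto_iff_norm_sub_tendsto_zero]
    refine squeeze_zero (fun _ => norm_nonneg _) (fun n => ?_) tendsto_one_div_add_atTop_nhds_zero_nat
    rw [norm_sub_rev]
    exact ((hw.memLp.norm_toLp_sub_lt (hφ n).memLp).2 (h1 n)).le
  have t2 : Tendsto (fun n => (hφ n).memLp_curl.toLp (classicalCurl (φ n))) atTop
      (𝓝 (hw.memLp_curl.toLp (weakCurl Ω e))) := by
    rw [tendsto_iff_norm_sub_tendsto_zero]
    refine squeeze_zero (fun _ => norm_nonneg _) (fun n => ?_) tendsto_one_div_add_atTop_nhds_zero_nat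
    rw [norm_sub_rev]
    exact ((hw.memLp_curl.norm_toLp_sub_lt (hφ n).memLp_curl).2 (h2 n)).le
  rw [← hw.memLp_curl.inner_toLp hb.memLp, ← hw.memLp.inner_toLp hb.memLp_curl]
  refine tendsto_nhds_unique (t2.inner tendsto_const_nhds) ((t1.inner tendsto_const_nhds).congr
    fun n => ?_)
  rw [(hφ n).memLp_curl.inner_toLp, (hφ n).memLp.inner_toLp]
  exact (hb.integral_eq (φ n) (hφ n)).symm

/-- The graph of the classical curl on test fields. -/
noncomputable def testGraph (Ω : Set R3) :
    Submodule ℂ (WithLp 2 (Lp C3 2 (volume.restrict Ω) × Lp C3 2 (volume.restrict Ω))) where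
  carrier := {p | ∃ (φ : R3 → C3) (h : IsTestField Ω φ),
    p = WithLp.toLp 2 (h.memLp.toLp φ, h.memLp_curl.toLp (classicalCurl φ))}
  add_mem' := by
    rintro _ _ ⟨φ, hφ, rfl⟩ ⟨ψ, hψ, rfl⟩
    refine ⟨φ + ψ, hφ.add hψ, ?_⟩
    simp only [classicalCurl_add hφ.smooth hψ.smooth]
    rfl
  zero_mem' := by
    have h0 : IsTestField Ω (0 : R3 → C3) :=
      ⟨contDiff_const, HasCompactSupport.zero, by simp [tsupport]⟩
    refine ⟨0, h0, ?_⟩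
    have hz : classicalCurl (0 : R3 → C3) = 0 := by
      ext x i
      fin_cases i <;> simp [classicalCurl, partialDeriv]
    simp only [hz]
    rfl
  smul_mem' := by
    rintro a _ ⟨φ, hφ, rfl⟩
    refine ⟨a • φ, hφ.smul a, ?_⟩
    simp only [classicalCurl_smul a hφ.smooth]
    rfl

/-- A field is in `H₀(curl; Ω)` with curl `g` if Green's formula holds for all fields of
`H(curl; Ω)`. -/
lemma memHCurlZero_of_integral_eq (hΩ : IsOpen Ω) {u g : R3 → C3}
    (hu : MemLp u 2 (volume.restrict Ω)) (hg : MemLp g 2 (volume.restrict Ω))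
    (h : ∀ b c : R3 → C3, IsL2Curl Ω b c →
      ∫ x in Ω, inner ℂ (c x) (u x) = ∫ x in Ω, inner ℂ (b x) (g x)) :
    IsL2Curl Ω u g ∧ MemHCurlZero Ω u := by
  have hcurl : IsL2Curl Ω u g := ⟨hu, hg, fun φ hφ => h φ _ hφ.isL2Curl⟩
  refine ⟨hcurl, ⟨g, hcurl⟩, fun δ hδ => ?_⟩
  have hmem : WithLp.toLp 2 (hu.toLp u, hg.toLp g) ∈ (testGraph Ω).topologicalClosure := by
    -- A pair `p` orthogonal to the graph on test fields is one whose second component has weak curl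
    -- minus the first. Hypothesis `h` for these two fields says precisely that `p` is orthogonal to
    -- `(u, g)`.
    rw [← Submodule.orthogonal_orthogonal_eq_closure, Submodule.mem_orthogonal]
    intro p hp
    have hb : IsL2Curl Ω (p.snd : Lp C3 2 (volume.restrict Ω))
        (-(p.fst : Lp C3 2 (volume.restrict Ω)) : R3 → C3) := by
      refine ⟨Lp.memLp p.snd, (Lp.memLp p.fst).neg, fun φ hφ => ?_⟩
      have h1 := (Submodule.mem_orthogonal _ _).1 hp _ ⟨φ, hφ, rfl⟩
      rw [WithLp.prod_inner_apply] at h1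
      change inner ℂ (hφ.memLp.toLp φ) p.fst
        + inner ℂ (hφ.memLp_curl.toLp (classicalCurl φ)) p.snd = 0 at h1
      rw [← Lp.toLp_coeFn p.fst (Lp.memLp _), ← Lp.toLp_coeFn p.snd (Lp.memLp _),
        MemLp.inner_toLp, MemLp.inner_toLp] at h1
      simp only [Pi.neg_apply, inner_neg_right, integral_neg]
      exact eq_neg_of_add_eq_zero_right h1
    have h2 := h _ _ hb
    simp only [Pi.neg_apply, inner_neg_left, integral_neg] at h2
    rw [WithLp.prod_inner_apply]
    change inner ℂ p.fst (hu.toLp u) + inner ℂ p.snd (hg.toLp g) = 0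
    rw [← Lp.toLp_coeFn p.fst (Lp.memLp _), ← Lp.toLp_coeFn p.snd (Lp.memLp _),
      MemLp.inner_toLp, MemLp.inner_toLp, ← h2]
    exact add_neg_cancel _
  obtain ⟨ε, hε, hεδ⟩ : ∃ ε : ℝ, 0 < ε ∧ ENNReal.ofReal ε ≤ δ := by
    rcases eq_or_ne δ ⊤ with rfl | hδt
    · exact ⟨1, one_pos, le_top⟩
    · exact ⟨δ.toReal, ENNReal.toReal_pos hδ.ne' hδt, ENNReal.ofReal_toReal_le⟩
  obtain ⟨_, ⟨φ, hφ, rfl⟩, hd⟩ := Metric.mem_closure_iff.1 hmem ε hε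
  rw [dist_eq_norm] at hd
  have h3 := WithLp.prod_norm_sq_eq_of_L2 (WithLp.toLp 2 (hu.toLp u, hg.toLp g)
    - WithLp.toLp 2 (hφ.memLp.toLp φ, hφ.memLp_curl.toLp (classicalCurl φ)))
  change _ = ‖hu.toLp u - hφ.memLp.toLp φ‖ ^ 2
    + ‖hg.toLp g - hφ.memLp_curl.toLp (classicalCurl φ)‖ ^ 2 at h3
  refine ⟨φ, hφ, ?_, ?_⟩
  · refine lt_of_lt_of_le ((hu.norm_toLp_sub_lt hφ.memLp).1 ?_) hεδ
    refine lt_of_le_of_lt (abs_le_of_sq_le_sq' ?_ (norm_nonneg _)).2 hd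
    rw [h3]
    exact le_add_of_nonneg_right (sq_nonneg _)
  · rw [eLpNorm_congr_ae ((weakCurl_ae_eq hΩ hcurl).sub (ae_eq_refl (classicalCurl φ)))]
    refine lt_of_lt_of_le ((hg.norm_toLp_sub_lt hφ.memLp_curl).1 ?_) hεδ
    refine lt_of_le_of_lt (abs_le_of_sq_le_sq' ?_ (norm_nonneg _)).2 hd
    rw [h3]
    exact le_add_of_nonneg_left (sq_nonneg _)

end Green

/-! ### The cold plasma operator is maximal accretive -/

namespace ColdPlasma

section Operator

variable {Ω : Set R3} {P : ColdPlasma Ω}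

lemma energySpace_ext {U V : P.EnergySpace} (h1 : U.fst = V.fst)
    (h2 : U.snd.fst = V.snd.fst) (h3 : U.snd.snd = V.snd.snd) : U = V :=
  (WithLp.ofLp_injective 2) (Prod.ext h1 ((WithLp.ofLp_injective 2) (Prod.ext h2 h3)))

lemma inner_energySpace (U V : P.EnergySpace) :
    inner ℂ U V = inner ℂ U.fst V.fst
      + (inner ℂ U.snd.fst V.snd.fst + inner ℂ U.snd.snd V.snd.snd) := by
  rw [WithLp.prod_inner_apply]
  congr 1

lemma inner_measE (a b : Lp C3 2 P.measE) :
    inner ℂ a b = P.ε₀ * ∫ x in Ω, inner ℂ (a x) (b x) := by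
  rw [L2.inner_def]
  refine (integral_smul_measure (fun x => inner ℂ (a x) (b x)) (ENNReal.ofReal P.ε₀)).trans ?_
  rw [ENNReal.toReal_ofReal P.ε₀_pos.le, Complex.real_smul]

lemma inner_measB (a b : Lp C3 2 P.measB) :
    inner ℂ a b = (P.c ^ 2 * P.ε₀ : ℝ) * ∫ x in Ω, inner ℂ (a x) (b x) := by
  rw [L2.inner_def]
  refine (integral_smul_measure (fun x => inner ℂ (a x) (b x))
    (ENNReal.ofReal (P.c ^ 2 * P.ε₀))).trans ?_
  rw [ENNReal.toReal_ofReal (mul_nonneg (sq_nonneg _) P.ε₀_pos.le), Complex.real_smul]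

lemma conj_integral_inner (μ : Measure R3) (f g : R3 → C3) :
    (starRingEnd ℂ) (∫ x, inner ℂ (f x) (g x) ∂μ) = ∫ x, inner ℂ (g x) (f x) ∂μ := by
  rw [← integral_conj]
  simp only [inner_conj_symm]

lemma coeFn_toLp_measE {f : R3 → C3} (hf : MemLp f 2 P.measE) :
    hf.toLp f =ᵐ[volume.restrict Ω] f :=
  P.ac_measE.ae_le hf.coeFn_toLp

lemma coeFn_toLp_measB {f : R3 → C3} (hf : MemLp f 2 P.measB) :
    hf.toLp f =ᵐ[volume.restrict Ω] f :=
  P.ac_measB.ae_le hf.coeFn_toLp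

lemma memLp_B (U : P.EnergySpace) : MemLp (B U) 2 (volume.restrict Ω) := by
  have h0 : 0 < P.c ^ 2 * P.ε₀ := mul_pos (pow_pos P.c_pos 2) P.ε₀_pos
  have h : MemLp (B U) 2 P.measB := Lp.memLp U.snd.snd
  have := h.smul_measure (c := (ENNReal.ofReal (P.c ^ 2 * P.ε₀))⁻¹) (by simpa using h0)
  rwa [measB, smul_smul, ENNReal.inv_mul_cancel (by simpa using h0) ENNReal.ofReal_ne_top,
    one_smul] at this

/-! #### The part of order zero -/

lemma memLp_sum_J (U : P.EnergySpace) :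
    MemLp (fun x => (1 / P.ε₀) • ∑ s, J U s x) 2 P.measE :=
  ((memLp_finsetSum Finset.univ fun s _ => memLp_J U s).const_smul (1 / P.ε₀)).smul_measure
    ENNReal.ofReal_ne_top

lemma memLp_collision (U : P.EnergySpace) (s : Fin 2) :
    MemLp (fun x => P.ν s x • J U s x) 2 (P.measJ s) := by
  have hJ : MemLp (J U s) 2 (P.measJ s) := Lp.memLp (U.fst s)
  obtain ⟨n, hn0, hn⟩ := P.bound_ν
  refine hJ.of_le_mul (c := n) ?_ ?_
  · exact ((P.aemeasurable_ν s).aestronglyMeasurable.smul (memLp_J U s).1).mono_ac (P.measJ_ac s)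
  · refine (P.measJ_ac s).ae_le ?_
    filter_upwards [hn s] with x hx
    rw [norm_smul, Real.norm_of_nonneg hx.1]
    gcongr
    exact hx.2

/-- The terms of order zero of the operator `𝔸₁`. -/
noncomputable def lowerOrder (U : P.EnergySpace) : P.EnergySpace :=
  WithLp.toLp 2 (WithLp.toLp 2 fun s => (memLp_fieldJ U s).toLp,
    WithLp.toLp 2 ((memLp_sum_J U).toLp, 0))

/-- Multiplication of the current densities by the collision frequencies. -/
noncomputable def collision (U : P.EnergySpace) : P.EnergySpace :=
  WithLp.toLp 2 (WithLp.toLp 2 fun s => (memLp_collision U s).toLp, 0)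

/-- The cross product with a real vector is skew-Hermitian, so the cyclotron terms cancel and the
collision term appears twice. -/
lemma inner_matM (s : Fin 2) (x : R3) (v w : C3) :
    inner ℂ (P.matM s x v) w + inner ℂ v (P.matM s x w) = 2 * inner ℂ v (P.ν s x • w) := by
  simp only [matM, crossR, PiLp.inner_apply, Fin.sum_univ_three]
  simp
  ring

lemma inner_toLp_matM (U V : P.EnergySpace) (s : Fin 2) :
    inner ℂ (memLp_matM U s).toLp (V.fst s) + inner ℂ (U.fst s) (memLp_matM V s).toLp
      = 2 * inner ℂ (U.fst s) (memLp_collision V s).toLp := by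
  rw [L2.inner_def, L2.inner_def, L2.inner_def, ← integral_add (L2.integrable_inner _ _)
    (L2.integrable_inner _ _), ← integral_const_mul]
  refine integral_congr_ae ?_
  filter_upwards [(memLp_matM U s).coeFn_toLp, (memLp_matM V s).coeFn_toLp,
    (memLp_collision V s).coeFn_toLp] with x h1 h2 h3
  rw [h1, h2, h3]
  exact inner_matM s x (J U s x) (J V s x)

/-- The factor `ε₀ ωₚₛ²` cancels the density of `measJ`. The weight is chosen so that this coupling
mirrors the one in `inner_toLp_sum_J`. -/
lemma inner_toLp_weight_E (U V : P.EnergySpace) (s : Fin 2) :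
    inner ℂ (memLp_weight_E U s).toLp (V.fst s) = ∫ x in Ω, inner ℂ (E U x) (J V s x) := by
  have h1 : inner ℂ (memLp_weight_E U s).toLp (V.fst s)
      = ∫ x, inner ℂ ((P.ε₀ * P.ωp s x ^ 2) • E U x) (J V s x) ∂P.measJ s := by
    rw [L2.inner_def]
    refine integral_congr_ae ?_
    filter_upwards [(memLp_weight_E U s).coeFn_toLp] with x h
    rw [h]
    rfl
  rw [h1, measJ, integral_withDensity_eq_integral_toReal_smul₀ (P.aemeasurable_weight s)
    (Eventually.of_forall fun _ => ENNReal.ofReal_lt_top)]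
  obtain ⟨w, -, hw⟩ := P.bound_ωp
  refine integral_congr_ae ?_
  filter_upwards [hw s] with x hx
  have h2 : 0 < P.ε₀ * P.ωp s x ^ 2 := mul_pos P.ε₀_pos (pow_pos hx.1 2)
  rw [ENNReal.toReal_ofReal (one_div_nonneg.2 h2.le), inner_smul_left_eq_smul, smul_smul,
    one_div_mul_cancel h2.ne', one_smul]

lemma inner_toLp_sum_J (U V : P.EnergySpace) :
    inner ℂ (memLp_sum_J U).toLp V.snd.fst = ∑ s, ∫ x in Ω, inner ℂ (J U s x) (E V x) := by
  rw [inner_measE, ← integral_finsetSum _ fun s _ =>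
    integrable_inner_of_memLp (memLp_J U s) (memLp_E V), ← integral_const_mul]
  refine integral_congr_ae ?_
  filter_upwards [coeFn_toLp_measE (memLp_sum_J U)] with x hx
  rw [hx, inner_smul_left_eq_smul, sum_inner, Complex.real_smul, ← mul_assoc, ← Complex.ofReal_mul,
    mul_one_div_cancel P.ε₀_pos.ne', Complex.ofReal_one, one_mul]
  rfl

lemma inner_lowerOrder (U V : P.EnergySpace) :
    inner ℂ (lowerOrder U) V = ∑ s, (inner ℂ (memLp_matM U s).toLp (V.fst s)
      - (∫ x in Ω, inner ℂ (E U x) (J V s x)) + ∫ x in Ω, inner ℂ (J U s x) (E V x)) := by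
  rw [inner_energySpace, PiLp.inner_apply]
  have h1 : ∀ s, inner ℂ ((lowerOrder U).fst s) (V.fst s)
      = inner ℂ (memLp_matM U s).toLp (V.fst s) - ∫ x in Ω, inner ℂ (E U x) (J V s x) := by
    intro s
    rw [← inner_toLp_weight_E, ← inner_sub_left, ← MemLp.toLp_sub]
    rfl
  have h2 : inner ℂ (lowerOrder U).snd.fst V.snd.fst
      = ∑ s, ∫ x in Ω, inner ℂ (J U s x) (E V x) := inner_toLp_sum_J U V
  have h3 : inner ℂ (lowerOrder U).snd.snd V.snd.snd = 0 := inner_zero_left _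
  rw [h2, h3, add_zero, Finset.sum_add_distrib]
  congr 1
  exact Finset.sum_congr rfl fun s _ => h1 s

lemma inner_collision (U V : P.EnergySpace) :
    inner ℂ U (collision V) = ∑ s, inner ℂ (U.fst s) (memLp_collision V s).toLp := by
  rw [inner_energySpace, PiLp.inner_apply]
  have h2 : inner ℂ U.snd.fst (collision V).snd.fst = 0 := inner_zero_right _
  have h3 : inner ℂ U.snd.snd (collision V).snd.snd = 0 := inner_zero_right _
  rw [h2, h3, add_zero, add_zero]
  rfl

/-- The exchange terms between `J` and `E` cancel, leaving only collisions. This also supplies the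
adjoint of `lowerOrder` as `2 collision - lowerOrder`, without writing out transposed matrices. -/
lemma inner_lowerOrder_add (U V : P.EnergySpace) :
    inner ℂ (lowerOrder U) V + inner ℂ U (lowerOrder V) = 2 * inner ℂ U (collision V) := by
  rw [← inner_conj_symm U, inner_lowerOrder, inner_lowerOrder, inner_collision, map_sum,
    ← Finset.sum_add_distrib, Finset.mul_sum]
  refine Finset.sum_congr rfl fun s _ => ?_
  rw [← inner_toLp_matM, map_add, map_sub, inner_conj_symm, conj_integral_inner, conj_integral_inner]
  ring

lemma re_inner_collision_nonneg (U : P.EnergySpace) : 0 ≤ (inner ℂ U (collision U)).re := by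
  rw [inner_collision, Complex.re_sum]
  refine Finset.sum_nonneg fun s _ => ?_
  obtain ⟨n, -, hn⟩ := P.bound_ν
  have h : inner ℂ (U.fst s) (memLp_collision U s).toLp
      = ∫ x, ((P.ν s x * ‖J U s x‖ ^ 2 : ℝ) : ℂ) ∂P.measJ s := by
    rw [L2.inner_def]
    refine integral_congr_ae ?_
    filter_upwards [(memLp_collision U s).coeFn_toLp] with x hx
    rw [hx]
    change inner ℂ (J U s x) _ = _
    rw [inner_smul_right_eq_smul, inner_self_eq_norm_sq_to_K, Complex.real_smul]
    push_cast
    rfl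
  rw [h, integral_complex_ofReal, Complex.ofReal_re]
  refine integral_nonneg_of_ae ((P.measJ_ac s).ae_le ?_)
  filter_upwards [hn s] with x hx
  exact mul_nonneg hx.1 (sq_nonneg _)

lemma re_inner_lowerOrder_nonneg (U : P.EnergySpace) : 0 ≤ (inner ℂ (lowerOrder U) U).re := by
  have h1 := congrArg Complex.re (inner_lowerOrder_add U U)
  rw [← inner_conj_symm U (lowerOrder U), Complex.add_re, Complex.conj_re] at h1
  have h2 := re_inner_collision_nonneg U
  have h3 : (2 * inner ℂ U (collision U)).re = 2 * (inner ℂ U (collision U)).re := by simp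
  linarith

/-! #### The skew-adjoint part -/

lemma memLp_curl_B (U : P.EnergySpace) (hB : MemHCurl Ω (B U)) :
    MemLp (weakCurl Ω (B U)) 2 P.measE :=
  (isL2Curl_weakCurl hB).memLp_curl.smul_measure ENNReal.ofReal_ne_top

/-- The first order terms `(0, 0, -c² curl B, curl E)` of the operator `𝔸₁`. -/
noncomputable def maxwell (U : P.EnergySpace) (hE : MemHCurl Ω (E U)) (hB : MemHCurl Ω (B U)) :
    P.EnergySpace :=
  WithLp.toLp 2 (0, WithLp.toLp 2 (-((P.c ^ 2) • (memLp_curl_B U hB).toLp), (memLp_fieldB U hE).toLp))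

lemma operatorA_sub_lowerOrder (hΩ : IsLipschitzDomain Ω) (U : (operatorA hΩ P).domain) :
    operatorA hΩ P U - lowerOrder U = maxwell U.1 U.2.1.1 U.2.2 := by
  refine energySpace_ext ?_ ?_ ?_
  · exact sub_self _
  · change (memLp_fieldE U.1 U.2.2).toLp - (memLp_sum_J U.1).toLp = _
    rw [sub_eq_iff_eq_add']
    change _ = (memLp_sum_J U.1).toLp + -((P.c ^ 2) • (memLp_curl_B U.1 U.2.2).toLp)
    rw [← sub_eq_add_neg, ← MemLp.toLp_const_smul, ← MemLp.toLp_sub]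
    rfl
  · exact sub_zero _

/-- The `c²` of the equation times the weight `ε₀` of the electric field equals the weight `c² ε₀`
of the magnetic field, so both curls carry the same factor. -/
lemma inner_maxwell_left {U : P.EnergySpace} (hE : MemHCurl Ω (E U)) (hB : MemHCurl Ω (B U))
    (V : P.EnergySpace) : inner ℂ (maxwell U hE hB) V = (P.c ^ 2 * P.ε₀ : ℝ) *
      ((∫ x in Ω, inner ℂ (weakCurl Ω (E U) x) (B V x))
        - ∫ x in Ω, inner ℂ (weakCurl Ω (B U) x) (E V x)) := by
  rw [inner_energySpace]
  have h1 : inner ℂ (maxwell U hE hB).fst V.fst = 0 := inner_zero_left _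
  have h2 : inner ℂ (maxwell U hE hB).snd.fst V.snd.fst
      = -((P.c ^ 2 : ℝ) * (P.ε₀ * ∫ x in Ω, inner ℂ (weakCurl Ω (B U) x) (E V x))) := by
    change inner ℂ (-((P.c ^ 2) • (memLp_curl_B U hB).toLp)) V.snd.fst = _
    rw [inner_neg_left, inner_smul_left_eq_smul, Complex.real_smul, inner_measE]
    congr 3
    refine integral_congr_ae ?_
    filter_upwards [coeFn_toLp_measE (memLp_curl_B U hB)] with x hx
    rw [hx]
    rfl
  have h3 : inner ℂ (maxwell U hE hB).snd.snd V.snd.snd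
      = (P.c ^ 2 * P.ε₀ : ℝ) * ∫ x in Ω, inner ℂ (weakCurl Ω (E U) x) (B V x) := by
    rw [inner_measB]
    congr 1
    refine integral_congr_ae ?_
    filter_upwards [coeFn_toLp_measB (memLp_fieldB U hE)] with x hx
    exact congrArg (fun z => inner ℂ z (B V x)) hx
  rw [h1, h2, h3]
  push_cast
  ring

lemma inner_eq_integral (U V : P.EnergySpace) : inner ℂ U V = inner ℂ U.fst V.fst
    + (P.ε₀ * (∫ x in Ω, inner ℂ (E U x) (E V x))
      + (P.c ^ 2 * P.ε₀ : ℝ) * ∫ x in Ω, inner ℂ (B U x) (B V x)) := by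
  rw [inner_energySpace, inner_measE, inner_measB]
  rfl

/-- Green's formula is used twice, each time moving the curl off the electric field of one state,
which lies in `H₀(curl)`, onto the magnetic field of the other. -/
lemma maxwell_skew {U W : P.EnergySpace} (hE : MemHCurlZero Ω (E U))
    (hB : MemHCurl Ω (B U)) (hE' : MemHCurlZero Ω (E W)) (hB' : MemHCurl Ω (B W)) :
    inner ℂ (maxwell W hE'.1 hB') U = -inner ℂ W (maxwell U hE.1 hB) := by
  rw [← inner_conj_symm W, inner_maxwell_left, inner_maxwell_left,
    hE'.integral_inner_curl (isL2Curl_weakCurl hB), hE.integral_inner_curl (isL2Curl_weakCurl hB')]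
  rw [map_mul, Complex.conj_ofReal, map_sub, conj_integral_inner, conj_integral_inner]
  ring

/-- The energy state with prescribed currents and fields. -/
noncomputable def mkState (j : PiLp 2 (fun s : Fin 2 => Lp C3 2 (P.measJ s))) {e b : R3 → C3}
    (he : MemLp e 2 (volume.restrict Ω)) (hb : MemLp b 2 (volume.restrict Ω)) : P.EnergySpace :=
  WithLp.toLp 2 (j, WithLp.toLp 2 ((he.smul_measure ENNReal.ofReal_ne_top : MemLp e 2 P.measE).toLp,
    (hb.smul_measure ENNReal.ofReal_ne_top : MemLp b 2 P.measB).toLp))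

lemma E_mkState (j : PiLp 2 (fun s : Fin 2 => Lp C3 2 (P.measJ s))) {e b : R3 → C3}
    (he : MemLp e 2 (volume.restrict Ω)) (hb : MemLp b 2 (volume.restrict Ω)) :
    E (mkState (P := P) j he hb) =ᵐ[volume.restrict Ω] e :=
  coeFn_toLp_measE (he.smul_measure ENNReal.ofReal_ne_top)

lemma B_mkState (j : PiLp 2 (fun s : Fin 2 => Lp C3 2 (P.measJ s))) {e b : R3 → C3}
    (he : MemLp e 2 (volume.restrict Ω)) (hb : MemLp b 2 (volume.restrict Ω)) :
    B (mkState (P := P) j he hb) =ᵐ[volume.restrict Ω] b :=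
  coeFn_toLp_measB (hb.smul_measure ENNReal.ofReal_ne_top)

/-- The weak form of the equation `maxwell U = H`, with fields of `H₀(curl; Ω)` and of
`H(curl; Ω)` as test functions. -/
lemma weak_form (hΩ : IsOpen Ω) {U H : P.EnergySpace}
    (h : ∀ (W : P.EnergySpace) (hE : MemHCurlZero Ω (E W)) (hB : MemHCurl Ω (B W)),
      inner ℂ (maxwell W hE.1 hB) U = -inner ℂ W H)
    (j : PiLp 2 (fun s : Fin 2 => Lp C3 2 (P.measJ s))) {e e' b b' : R3 → C3}
    (he : MemHCurlZero Ω e) (he' : IsL2Curl Ω e e') (hb : IsL2Curl Ω b b') :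
    (P.c ^ 2 * P.ε₀ : ℝ) * ((∫ x in Ω, inner ℂ (e' x) (B U x))
        - ∫ x in Ω, inner ℂ (b' x) (E U x))
      = -(inner ℂ j H.fst + (P.ε₀ * (∫ x in Ω, inner ℂ (e x) (E H x))
        + (P.c ^ 2 * P.ε₀ : ℝ) * ∫ x in Ω, inner ℂ (b x) (B H x))) := by
  have h1 := E_mkState (P := P) j he'.memLp hb.memLp
  have h2 := B_mkState (P := P) j he'.memLp hb.memLp
  have hE := he.congr hΩ h1.symm
  have hB : MemHCurl Ω (B (mkState (P := P) j he'.memLp hb.memLp)) :=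
    ⟨b', hb.congr h2.symm ae_eq_rfl⟩
  have h3 := weakCurl_ae_eq hΩ (he'.congr h1.symm ae_eq_rfl)
  have h4 := weakCurl_ae_eq hΩ (hb.congr h2.symm ae_eq_rfl)
  have hcongr : ∀ {f g k : R3 → C3}, f =ᵐ[volume.restrict Ω] g →
      ∫ x in Ω, inner ℂ (f x) (k x) = ∫ x in Ω, inner ℂ (g x) (k x) := fun hfg =>
    integral_congr_ae (by filter_upwards [hfg] with x hx; rw [hx])
  have h5 := h _ hE hB
  rw [inner_maxwell_left, inner_eq_integral, hcongr h1, hcongr h2, hcongr h3, hcongr h4] at h5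
  exact h5

/-- Skew-adjointness: the three components of the test state can be varied independently, and each
determines one component of the equation together with the regularity it requires. -/
lemma eq_maxwell_of_weak_form (hΩ : IsOpen Ω) {U H : P.EnergySpace}
    (h : ∀ (W : P.EnergySpace) (hE : MemHCurlZero Ω (E W)) (hB : MemHCurl Ω (B W)),
      inner ℂ (maxwell W hE.1 hB) U = -inner ℂ W H) :
    ∃ (hE : MemHCurlZero Ω (E U)) (hB : MemHCurl Ω (B U)), maxwell U hE.1 hB = H := by
  have hc : P.c ^ 2 ≠ 0 := (pow_pos P.c_pos 2).ne'
  have hε : (P.ε₀ : ℂ) ≠ 0 := Complex.ofReal_ne_zero.2 P.ε₀_pos.ne'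
  have hcε : ((P.c ^ 2 * P.ε₀ : ℝ) : ℂ) ≠ 0 :=
    Complex.ofReal_ne_zero.2 (mul_ne_zero hc P.ε₀_pos.ne')
  have h0 := isL2Curl_zero Ω
  have h0' := memHCurlZero_zero hΩ
  have hH1 : H.fst = 0 := by
    -- Only currents: testing with `H.fst` itself gives `⟨H.fst, H.fst⟩ = 0`.
    have h1 := weak_form hΩ h H.fst h0' h0 h0
    simp only [Pi.zero_apply, inner_zero_left, integral_zero, sub_self, mul_zero, add_zero] at h1
    exact inner_self_eq_zero.1 (neg_eq_zero.1 h1.symm)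
  have hB : IsL2Curl Ω (B U) (fun x => (-(P.c ^ 2)⁻¹) • E H x) := by
    refine ⟨memLp_B U, (memLp_E H).const_smul (-(P.c ^ 2)⁻¹), fun φ hφ => ?_⟩
    -- Only a smooth electric test field: this is the definition of the weak curl of `B U`.
    have h1 := weak_form hΩ h 0 (hφ.memHCurlZero hΩ) hφ.isL2Curl h0
    simp only [Pi.zero_apply, inner_zero_left, integral_zero, mul_zero, add_zero, zero_add,
      sub_zero] at h1
    have hcc : (P.c : ℂ) ≠ 0 := Complex.ofReal_ne_zero.2 P.c_pos.ne'
    simp only [inner_smul_right_eq_smul, Complex.real_smul, integral_const_mul]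
    refine mul_left_cancel₀ hcε (h1.trans ?_)
    push_cast
    field_simp
  have hE : IsL2Curl Ω (E U) (B H) ∧ MemHCurlZero Ω (E U) := by
    refine memHCurlZero_of_integral_eq hΩ (memLp_E U) (memLp_B H) fun b b' hb => ?_
    -- Only a magnetic test field, arbitrary in `H(curl)`: this is what forces the vanishing
    -- tangential trace of `E U`.
    have h1 := weak_form hΩ h 0 h0' h0 hb
    simp only [Pi.zero_apply, inner_zero_left, integral_zero, mul_zero, zero_add,
      zero_sub, mul_neg] at h1
    exact mul_left_cancel₀ hcε (neg_injective h1)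
  refine ⟨hE.2, ⟨_, hB⟩, energySpace_ext hH1.symm ?_ ?_⟩
  · change -((P.c ^ 2) • (memLp_curl_B U ⟨_, hB⟩).toLp) = H.snd.fst
    rw [← MemLp.toLp_const_smul, ← MemLp.toLp_neg]
    refine Lp.ext ((MemLp.coeFn_toLp _).trans (P.measE_ac.ae_le ?_))
    filter_upwards [weakCurl_ae_eq hΩ hB] with x hx
    change -((P.c ^ 2) • weakCurl Ω (B U) x) = E H x
    rw [hx, smul_smul, mul_neg, mul_inv_cancel₀ hc, neg_smul, one_smul, neg_neg]
  · change (memLp_fieldB U hE.2.1).toLp = H.snd.snd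
    refine Lp.ext ((MemLp.coeFn_toLp _).trans (P.measB_ac.ae_le ?_))
    exact weakCurl_ae_eq hΩ hE.1

theorem isMaximalAccretive_operatorA (hΩ : IsLipschitzDomain Ω) (P : ColdPlasma Ω) :
    IsMaximalAccretive (operatorA hΩ P) := by
  refine isMaximalAccretive_of_skewAdjoint (K := lowerOrder)
    (K' := fun U => (2 : ℂ) • collision U - lowerOrder U) (fun U V => ?_)
    re_inner_lowerOrder_nonneg (fun U F => ?_)
  · rw [inner_sub_right, inner_smul_right, ← inner_lowerOrder_add, add_sub_cancel_right]
  simp only [operatorA_sub_lowerOrder]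
  constructor
  · intro hUF W
    obtain ⟨⟨V, hV⟩, rfl, rfl⟩ := (LinearPMap.mem_graph_iff _).1 hUF
    rw [operatorA_sub_lowerOrder hΩ ⟨V, hV⟩]
    exact maxwell_skew hV.1 hV.2 W.2.1 W.2.2
  · intro h
    -- The weak equation determines the first order part, `maxwell U = F - lowerOrder U`; adding
    -- `lowerOrder U` back recovers the graph of the full operator.
    obtain ⟨hE, hB, e⟩ := eq_maxwell_of_weak_form hΩ.isOpen (U := U) (H := F - lowerOrder U)
      fun W hE hB => h ⟨W, hE, hB⟩
    refine (LinearPMap.mem_graph_iff _).2 ⟨⟨U, hE, hB⟩, rfl, ?_⟩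
    have h1 := operatorA_sub_lowerOrder hΩ (P := P) ⟨U, hE, hB⟩
    exact sub_left_injective (h1.trans e)

end Operator

end ColdPlasma

/-- Well-posedness of the cold plasma model with a perfectly conducting boundary. -/
theorem mainTheorem1 (Ω : Set R3) (hΩ : IsLipschitzDomain Ω) (P : ColdPlasma Ω) :
    ∃ T : ℝ≥0 → P.EnergySpace →L[ℂ] P.EnergySpace,
      IsC0Semigroup T ∧ (∀ t, ‖T t‖ ≤ 1) ∧ IsGenerator (-ColdPlasma.operatorA hΩ P) T ∧
      ∀ U₀ : P.EnergySpace, ∃ U : ℝ → P.EnergySpace,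
        (∀ t : ℝ≥0, U t = T t U₀) ∧
        IsMildSolution (ColdPlasma.operatorA hΩ P) U₀ U ∧
        (∀ V, IsMildSolution (ColdPlasma.operatorA hΩ P) U₀ V → EqOn V U (Ici 0)) ∧
        (∀ t, 0 ≤ t → ‖U t‖ ≤ ‖U₀‖) ∧
        ∀ h₀ : U₀ ∈ (ColdPlasma.operatorA hΩ P).domain,
          IsClassicalSolution (ColdPlasma.operatorA hΩ P) U₀ U ∧
          (∀ V, IsClassicalSolution (ColdPlasma.operatorA hΩ P) U₀ V → EqOn V U (Ici 0)) ∧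
          IsC1 U ∧
          ContinuousIntoDomain (ColdPlasma.operatorA hΩ P) U ∧
          ∀ t, 0 ≤ t → ‖timeDeriv U t‖ ≤ ‖ColdPlasma.operatorA hΩ P ⟨U₀, h₀⟩‖ :=
  (ColdPlasma.isMaximalAccretive_operatorA hΩ P).wellPosed
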